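/- Let $\Omega=\mathbb R^2\times(0,\infty)\subset\mathbb R^3$, identify $\partial\Omega=\mathbb R^2\times\{0\}$ with $\mathbb R^2$, let $\mathbf e_3=(0,0,1)$, and put $\partial^\Omega E:=\Omega\cap\partial E$. A \emph{droplet} is a bounded measurable set $E\subset\Omega$ that coincides with the set of its points of Lebesgue density one. For droplets write $E\prec F$ if $E\subset F$ and $\mathrm{dist}(\partial^\Omega E,\partial^\Omega F)>0$ (the distance to the empty set being $+\infty$). Let $0<T^\dagger\le\infty$, $s\in\mathbb R$, and let $\beta\in C^{1+\gamma}(\partial\Omega)$ for some $\gamma\in(0,1]$ satisfy $\|\beta\|_\infty\le 1-2\eta$ for some $\eta\in(0,1/2)$. A family $\{E(t)\}_{t\in[0,T^\dagger)}$ of droplets is a \emph{smooth flow with forcing $s$ and contact angle $\beta$} if for every $S\in(0,T^\dagger)$ there are $\alpha\in(0,1]$, a bounded open set $\mathscr U\subset\mathbb R^2$ with $C^{2+\alpha}$ boundary and a map $p\in C^{1+\alpha/2,\,2+\alpha}([0,S]\times\overline{\mathscr U};\mathbb R^3)$ such that, for every $t\in[0,S]$ and with $\Gamma(t):=\partial^\Omega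 E(t)$: (i) $p(t,\cdot)$ is a $C^{2+\alpha}$ diffeomorphism of $\overline{\mathscr U}$ onto its image with $p(t,\mathscr U)=\Gamma(t)$, $p(t,\partial\mathscr U)=\partial\Gamma(t):=\overline{\Gamma(t)}\setminus\Gamma(t)$, $p\cdot\mathbf e_3>0$ in $\mathscr U$ and $p\cdot\mathbf e_3=0$ on $\partial\mathscr U$; (ii) $\nu_{E(t)}\cdot\mathbf e_3=-\beta$ on $\partial\Omega\cap\overline{\Gamma(t)}$, where $\nu_{E(t)}$ is the unit normal to $\Gamma(t)$ outer to $E(t)$, extended continuously to $\overline{\Gamma(t)}$; (iii) for $0<t<S$, $v_{E(t)}=-\kappa_{E(t)}+s$ on $\Gamma(t)$, where $v_{E(t)}=\partial_t p\cdot\nu_{E(t)}$ is the normal velocity and $\kappa_{E(t)}$ is the mean curvature (sum of the principal curvatures, nonnegative for convex sets) with respect to $\nu_{E(t)}$. \textbf{Theorem (Strong comparison).} Let $\{E_1(t)\}_{t\in[0,T^\dagger)}$ and $\{E_2(t)\}_{t\in[0,T^\dagger)}$ be smooth flows with forcings $s_1,s_2$ and contact angles $\beta_1,\beta_2$, respectively.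 Assume that $E_1(0)\prec E_2(0)$, $s_1\le s_2$, and $\beta_1>\beta_2$ pointwise on $\partial\Omega$. Then $E_1(t)\prec E_2(t)$ for all $t\in[0,T^\dagger)$. -/

import Mathlib

open Set Filter Topology MeasureTheory
open scoped NNReal

noncomputable section

namespace Droplet

/-- The parameter plane `ℝ²`, also used for the boundary `∂Ω = ℝ² × {0}`. -/
abbrev Plane := EuclideanSpace ℝ (Fin 2)

/-- The ambient space `ℝ³`. -/
abbrev Space := EuclideanSpace ℝ (Fin 3)

/-- The open upper half-space `Ω = ℝ² × (0, ∞)`. -/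
def halfSpace : Set Space := {x | 0 < x 2}

/-- The unit vector `e₃`. -/
def e3 : Space := EuclideanSpace.single 2 1

/-- The point of `∂Ω ≅ ℝ²` below `x`, that is `(x₁, x₂)`. -/
def toPlane (x : Space) : Plane := !₂[x 0, x 1]

/-- `∂^Ω E = Ω ∩ ∂E`. -/
def innerBoundary (E : Set Space) : Set Space := halfSpace ∩ frontier E

/-- `E ≺ F`: inclusion, and the boundaries inside `Ω` have positive distance
(the distance to an empty set being `+∞`). -/
def StrictlyInside (E F : Set Space) : Prop :=
  E ⊆ F ∧ ∃ δ : ℝ, 0 < δ ∧ ∀ x ∈ innerBoundary E, ∀ y ∈ innerBoundary F, δ ≤ dist x y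

/-- A bounded measurable subset of `Ω` that coincides with the set of its points of
Lebesgue density one. -/
structure IsDroplet (E : Set Space) : Prop where
  subset : E ⊆ halfSpace
  bounded : Bornology.IsBounded E
  measurable : MeasurableSet E
  density : ∀ x, x ∈ E ↔
    Tendsto (fun r : ℝ => volume (E ∩ Metric.ball x r) / volume (Metric.ball x r))
      (𝓝[>] 0) (𝓝 1)

/-- Bounded open subsets of the plane with boundary of class `C^{2+α}`: near each boundary
point the set is the sublevel set `{φ < 0}` of a `C^{2+α}` function with nonzero differential. -/
structure IsHolderDomain (α : ℝ≥0) (U : Set Plane) : Prop where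
  isOpen : IsOpen U
  bounded : Bornology.IsBounded U
  boundary : ∀ x ∈ frontier U, ∃ r : ℝ, 0 < r ∧ ∃ φ : Plane → ℝ,
    ContDiffOn ℝ 2 φ (Metric.ball x r) ∧
    (∃ C : ℝ≥0, HolderOnWith C α (iteratedFDeriv ℝ 2 φ) (Metric.ball x r)) ∧
    φ x = 0 ∧ fderiv ℝ φ x ≠ 0 ∧
    U ∩ Metric.ball x r = {y | φ y < 0} ∩ Metric.ball x r

/-- `q` is a `C^{2+α}` diffeomorphism of the closure of `U` onto the closure of the surface `Γ`
that maps `U` onto `Γ` and `∂U` onto `∂Γ`, positive height in `U` and zero height on `∂U`. -/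
structure IsParametrization (α : ℝ≥0) (U : Set Plane) (q : Plane → Space) (Γ : Set Space) :
    Prop where
  contDiffOn : ContDiffOn ℝ 2 q (closure U)
  holder : ∃ C : ℝ≥0,
    HolderOnWith C α (iteratedFDerivWithin ℝ 2 q (closure U)) (closure U)
  injOn : InjOn q (closure U)
  immersion : ∀ u ∈ closure U, Function.Injective (fderivWithin ℝ q (closure U) u)
  image_interior : q '' U = Γ
  image_boundary : q '' frontier U = closure Γ \ Γ
  height_pos : ∀ u ∈ U, 0 < q u 2
  height_zero : ∀ u ∈ frontier U, q u 2 = 0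

/-- Hölder continuity on `[0, S] × closure U`, exponent `α / 2` in time and `α` in space. -/
def ParabolicHolderOn {F : Type*} [NormedAddCommGroup F] (α : ℝ≥0) (S : ℝ) (U : Set Plane)
    (f : ℝ → Plane → F) : Prop :=
  ∃ C : ℝ, ∀ t ∈ Icc 0 S, ∀ t' ∈ Icc 0 S, ∀ u ∈ closure U, ∀ u' ∈ closure U,
    ‖f t u - f t' u'‖ ≤ C * (|t - t'| ^ ((α : ℝ) / 2) + ‖u - u'‖ ^ (α : ℝ))

/-- The parabolic Hölder class `C^{1+α/2, 2+α}([0, S] × closure U; ℝ³)`. -/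
structure IsParabolicClass (α : ℝ≥0) (S : ℝ) (U : Set Plane) (p : ℝ → Plane → Space) :
    Prop where
  space_contDiffOn : ∀ t ∈ Icc 0 S, ContDiffOn ℝ 2 (p t) (closure U)
  time_differentiable : ∀ u ∈ closure U, DifferentiableOn ℝ (fun t => p t u) (Icc 0 S)
  continuousOn : ContinuousOn (fun z : ℝ × Plane => p z.1 z.2) (Icc 0 S ×ˢ closure U)
  continuousOn_fderiv : ContinuousOn
    (fun z : ℝ × Plane => fderivWithin ℝ (p z.1) (closure U) z.2) (Icc 0 S ×ˢ closure U)
  holder_time : ParabolicHolderOn α S U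
    (fun t u => derivWithin (fun τ => p τ u) (Icc 0 S) t)
  holder_space : ParabolicHolderOn α S U
    (fun t u => iteratedFDerivWithin ℝ 2 (p t) (closure U) u)

/-- `N u` is the unit normal, outer to `E`, of the surface parametrized by `q` at the point
`q u`; on `∂U` it is given by continuous extension. -/
structure IsOuterNormal (U : Set Plane) (q : Plane → Space) (E : Set Space)
    (N : Plane → Space) : Prop where
  continuousOn : ContinuousOn N (closure U)
  norm_eq_one : ∀ u ∈ closure U, ‖N u‖ = 1
  orthogonal : ∀ u ∈ closure U, ∀ w : Plane,
    inner ℝ (fderivWithin ℝ q (closure U) u w) (N u) = 0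
  outer : ∀ u ∈ U, ∀ᶠ ε : ℝ in 𝓝[>] 0, q u + ε • N u ∉ E ∧ q u - ε • N u ∈ E

/-- The partial derivative `∂ᵢ q`. -/
def partialD (q : Plane → Space) (i : Fin 2) (u : Plane) : Space :=
  fderiv ℝ q u (EuclideanSpace.single i 1)

/-- The first fundamental form `gᵢⱼ = ∂ᵢ q · ∂ⱼ q`. -/
def firstForm (q : Plane → Space) (u : Plane) : Matrix (Fin 2) (Fin 2) ℝ :=
  Matrix.of fun i j => inner ℝ (partialD q i u) (partialD q j u)

/-- The second fundamental form with respect to the unit normal `n`, `hᵢⱼ = - ∂ᵢ∂ⱼ q · n`;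
it is nonnegative for a convex body with outer normal `n`. -/
def secondForm (q : Plane → Space) (n : Space) (u : Plane) : Matrix (Fin 2) (Fin 2) ℝ :=
  Matrix.of fun i j => - inner ℝ (partialD (partialD q j) i u) n

/-- The mean curvature (sum of the principal curvatures) `tr (g⁻¹ h)` at `q u`, `u ∈ U`. -/
def meanCurvature (q : Plane → Space) (n : Space) (u : Plane) : ℝ :=
  ((firstForm q u)⁻¹ * secondForm q n u).trace

/-- `β ∈ C^{1+α}(∂Ω)` for some `α ∈ (0, 1]`, and `‖β‖_∞ ≤ 1 - 2η` for some `η ∈ (0, 1/2)`. -/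
structure IsContactAngle (β : Plane → ℝ) : Prop where
  contDiff : ContDiff ℝ 1 β
  holder : ∃ α : ℝ≥0, 0 < α ∧ α ≤ 1 ∧ ∃ C : ℝ≥0, HolderWith C α (fderiv ℝ β)
  coercive : ∃ η : ℝ, 0 < η ∧ η < 1 / 2 ∧ ∀ x, |β x| ≤ 1 - 2 * η

/-- `{E t}`, `t ∈ [0, T)`, is a smooth mean curvature flow of droplets with forcing `s` and
contact angle `β`: on each `[0, S]`, `0 < S < T`, the surfaces `∂^Ω E t` are parametrized over a
fixed domain in the class `C^{1+α/2, 2+α}`, the outer unit normal `N` satisfies `N · e₃ = -β` on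
`∂Ω`, and the normal velocity `∂ₜ p · N` equals `-κ + s`. -/
structure IsSmoothFlow (T : EReal) (s : ℝ) (β : Plane → ℝ) (E : ℝ → Set Space) : Prop where
  angle : IsContactAngle β
  droplet : ∀ t : ℝ, 0 ≤ t → (t : EReal) < T → IsDroplet (E t)
  evolution : ∀ S : ℝ, 0 < S → (S : EReal) < T →
    ∃ (α : ℝ≥0) (U : Set Plane) (p N : ℝ → Plane → Space),
      0 < α ∧ α ≤ 1 ∧ IsHolderDomain α U ∧ IsParabolicClass α S U p ∧
      (∀ t ∈ Icc 0 S, IsParametrization α U (p t) (innerBoundary (E t))) ∧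
      (∀ t ∈ Icc 0 S, IsOuterNormal U (p t) (E t) (N t)) ∧
      (∀ t ∈ Icc 0 S, ∀ u ∈ frontier U, inner ℝ (N t u) e3 = - β (toPlane (p t u))) ∧
      (∀ t ∈ Ioo 0 S, ∀ u ∈ U,
        inner ℝ (deriv (fun τ => p τ u) t) (N t u) = - meanCurvature (p t) (N t u) u + s)

end Droplet

end

/-! The proof is a maximum principle for the squared distance between the two closed surfaces. If
they ever met, there would be a first time `r` at which `dist² + ε t` falls to a small level `l`.
With `ε` small the surfaces are still disjoint on `[0, r]`, so the inclusion persists up to time `r`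
(`inclusion_of_disjoint`), and the distance `d > 0` at time `r` is attained at two points whose
difference is `d n` with `n` a unit vector pointing to the outer side of both sets
(`inner_normal_nonneg_of_nearest`).

Neither point can lie on `∂Ω`. If one did, both would be low, and the first variation would give `N₂
· e₃ ≤ n · e₃ ≤ N₁ · e₃`. Near `∂Ω` the outer terms are `-β₂` and `-β₁` up to a small error, which
contradicts the uniform gap between the angles (`exists_interior_of_nearest`). At interior nearest
points `n` is the outer normal of both surfaces. The second variation under a common translation of
both points gives `κ₂ ≤ κ₁`, and the two laws then show that the distance does not decrease to first
order (`inner_velocity_nonneg`). Hence `dist² + ε t` has derivative at least `ε > 0` at its first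
passage to `l` from above, which is impossible (`disjoint_of_evolutions`).

The remaining work is about sides. Only the surfaces are assumed to depend continuously on time, not
the sets, and the normals are continuous in space only. The chord estimate `exists_chord_bound`
makes the surfaces uniformly flat for nearby times, so cones around the normal lie on one side. A
connectedness argument starting from a point that is always outside then shows that membership off
the surface is locally constant in time (`IsEvolution.eventually_mem_iff`). Normals at nearby times
are controlled up to sign by `eventually_normal_near`. -/

noncomputable section

namespace Droplet

/-! ### Linear algebra in the plane and in space -/

/-- The orthogonal complement of the image of an injective linear map from the plane to space is
spanned by any of its nonzero vectors. -/
theorem range_eq_orthogonal (A : Plane →L[ℝ] Space) (hA : Function.Injective A) {n : Space}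
    (hn : n ≠ 0) (hAn : ∀ w, inner ℝ (A w) n = 0) :
    LinearMap.range (A : Plane →ₗ[ℝ] Space) = (ℝ ∙ n)ᗮ := by
  have h1 : Module.finrank ℝ (LinearMap.range (A : Plane →ₗ[ℝ] Space)) = 2 := by
    rw [LinearMap.finrank_range_of_inj hA]; simp
  have h2 : Module.finrank ℝ ((ℝ ∙ n)ᗮ : Submodule ℝ Space) = 2 := by
    have := Submodule.finrank_add_finrank_orthogonal (ℝ ∙ n)
    rw [finrank_span_singleton hn] at this
    simp at this
    omega
  refine Submodule.eq_of_le_of_finrank_eq ?_ (h1.trans h2.symm)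
  rintro _ ⟨w, rfl⟩
  rw [Submodule.mem_orthogonal_singleton_iff_inner_left]
  exact hAn w

theorem mem_range_of_inner_eq_zero (A : Plane →L[ℝ] Space) (hA : Function.Injective A)
    {n : Space} (hn : n ≠ 0) (hAn : ∀ w, inner ℝ (A w) n = 0) {v : Space}
    (hv : inner ℝ v n = 0) : ∃ w, A w = v := by
  have : v ∈ LinearMap.range (A : Plane →ₗ[ℝ] Space) := by
    rw [range_eq_orthogonal A hA hn hAn, Submodule.mem_orthogonal_singleton_iff_inner_left]
    exact hv
  exact this

theorem eq_inner_smul_of_orthogonal (A : Plane →L[ℝ] Space) (hA : Function.Injective A)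
    {n : Space} (hn : ‖n‖ = 1) (hAn : ∀ w, inner ℝ (A w) n = 0) {v : Space}
    (hv : ∀ w, inner ℝ (A w) v = 0) : v = inner ℝ v n • n := by
  have hn0 : n ≠ 0 := by rintro rfl; simp at hn
  have h1 : inner ℝ (v - inner ℝ v n • n) n = 0 := by
    rw [inner_sub_left, real_inner_smul_left, real_inner_self_eq_norm_sq, hn]; ring
  obtain ⟨w, hw⟩ := mem_range_of_inner_eq_zero A hA hn0 hAn h1
  have h2 : inner ℝ (v - inner ℝ v n • n) (v - inner ℝ v n • n) = 0 := by
    nth_rewrite 1 [← hw]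
    rw [inner_sub_right, hv, real_inner_smul_right, hAn]; simp
  exact sub_eq_zero.1 (inner_self_eq_zero.1 h2)

theorem eq_or_eq_neg_of_orthogonal (A : Plane →L[ℝ] Space) (hA : Function.Injective A)
    {n v : Space} (hn : ‖n‖ = 1) (hAn : ∀ w, inner ℝ (A w) n = 0) (hv1 : ‖v‖ = 1)
    (hv : ∀ w, inner ℝ (A w) v = 0) : v = n ∨ v = -n := by
  have h := eq_inner_smul_of_orthogonal A hA hn hAn hv
  have h2 : |inner ℝ v n| = 1 := by
    have := congrArg norm h
    rw [norm_smul, hn, hv1, Real.norm_eq_abs] at this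
    linarith
  rcases eq_or_eq_neg_of_abs_eq h2 with h3 | h3
  · left; rw [h, h3, one_smul]
  · right; rw [h, h3, neg_smul, one_smul]

/-- Unit normals depend continuously, up to sign, on the tangent plane. -/
theorem eventually_normal_near (A₀ : Plane →L[ℝ] Space) (hA : Function.Injective A₀)
    {n : Space} (hn : ‖n‖ = 1) (hAn : ∀ w, inner ℝ (A₀ w) n = 0) {ε : ℝ} (hε : 0 < ε) :
    ∀ᶠ A in 𝓝 A₀, ∀ v : Space, ‖v‖ = 1 → (∀ w, inner ℝ (A w) v = 0) →
      v ∈ Metric.ball n ε ∪ Metric.ball (-n) ε := by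
  have hK : IsCompact (Metric.sphere (0 : Space) 1) := isCompact_sphere _ _
  have := hK.eventually_forall_of_forall_eventually (x₀ := A₀)
    (P := fun A v => (∀ w, inner ℝ (A w) v = 0) →
      v ∈ Metric.ball n ε ∪ Metric.ball (-n) ε) ?_
  · filter_upwards [this] with A hA v hv
    exact hA v (by simpa using hv)
  · intro v hv
    have hv1 : ‖v‖ = 1 := by simpa using hv
    by_cases h : ∀ w, inner ℝ (A₀ w) v = 0
    · have hmem : v ∈ Metric.ball n ε ∪ Metric.ball (-n) ε := by
        rcases eq_or_eq_neg_of_orthogonal A₀ hA hn hAn hv1 h with rfl | rfl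
        · left; exact Metric.mem_ball_self hε
        · right; exact Metric.mem_ball_self hε
      have ho : IsOpen (Metric.ball n ε ∪ Metric.ball (-n) ε) :=
        Metric.isOpen_ball.union Metric.isOpen_ball
      have : ∀ᶠ z : (Plane →L[ℝ] Space) × Space in 𝓝 (A₀, v),
          z.2 ∈ Metric.ball n ε ∪ Metric.ball (-n) ε :=
        continuous_snd.continuousAt.eventually (ho.mem_nhds hmem)
      filter_upwards [this] with z hz _ using hz
    · push Not at h
      obtain ⟨w, hw⟩ := h
      have hc : Continuous fun z : (Plane →L[ℝ] Space) × Space => inner ℝ (z.1 w) z.2 := by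
        fun_prop
      have : ∀ᶠ z : (Plane →L[ℝ] Space) × Space in 𝓝 (A₀, v), inner ℝ (z.1 w) z.2 ≠ 0 :=
        hc.continuousAt.eventually_ne hw
      filter_upwards [this] with z hz h
      exact absurd (h w) hz

/-- A linear functional which is nonpositive on the open half-plane `g < 0` is a nonnegative
multiple of `g`. -/
theorem exists_nonneg_smul_of_nonpos {g ℓ : Plane →L[ℝ] ℝ} (hg : g ≠ 0)
    (h : ∀ w, g w < 0 → ℓ w ≤ 0) : ∃ c : ℝ, 0 ≤ c ∧ ∀ w, ℓ w = c * g w := by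
  obtain ⟨w₁, hw₁⟩ : ∃ w, g w ≠ 0 := by
    by_contra! hc
    exact hg (ContinuousLinearMap.ext hc)
  obtain ⟨w₀, hw₀⟩ : ∃ w, g w = -1 :=
    ⟨(-(g w₁)⁻¹) • w₁, by simp [hw₁]⟩
  have hker : ∀ k, g k = 0 → ℓ k = 0 := by
    intro k hk
    by_contra hne
    -- Adding a multiple of `k` keeps `g = -1`; this multiple brings `ℓ` to the forbidden value `1`.
    have := h (w₀ + ((1 - ℓ w₀) / ℓ k) • k) (by simp [hk, hw₀])
    rw [map_add, map_smul, smul_eq_mul, div_mul_cancel₀ _ hne] at this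
    linarith
  refine ⟨-ℓ w₀, by linarith [h w₀ (by rw [hw₀]; norm_num)], fun w => ?_⟩
  have := hker (w + g w • w₀) (by simp [hw₀])
  rw [map_add, map_smul, smul_eq_mul] at this
  linarith

/-- The hypothesis says that the columns of `W` are orthonormal for `G`, hence `G⁻¹ = W Wᵀ`, and the
trace is cyclic. -/
theorem trace_inv_mul_eq (G H W : Matrix (Fin 2) (Fin 2) ℝ) (h : W.transpose * G * W = 1) :
    (G⁻¹ * H).trace = (W.transpose * H * W).trace := by
  have h1 : W * (W.transpose * G) = 1 := mul_eq_one_comm.1 h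
  have h2 : G⁻¹ = W * W.transpose := Matrix.inv_eq_left_inv (by rw [Matrix.mul_assoc, h1])
  rw [h2, Matrix.mul_assoc, Matrix.trace_mul_comm]

theorem plane_sum (w : Plane) :
    w 0 • EuclideanSpace.single 0 (1 : ℝ) + w 1 • EuclideanSpace.single 1 (1 : ℝ) = w := by
  ext i; fin_cases i <;> simp

/-- The mean curvature computed in an orthonormal basis of the tangent plane. -/
theorem meanCurvature_eq_sum {q : Plane → Space} {u : Plane} (hq : ContDiffAt ℝ 2 q u)
    (n : Space) (w : Fin 2 → Plane)
    (hw : ∀ k l, inner ℝ (fderiv ℝ q u (w k)) (fderiv ℝ q u (w l)) = if k = l then 1 else 0) :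
    meanCurvature q n u = ∑ k, -inner ℝ (fderiv ℝ (fderiv ℝ q) u (w k) (w k)) n := by
  have hd : DifferentiableAt ℝ (fderiv ℝ q) u :=
    (hq.fderiv_right (m := 1) (by norm_num)).differentiableAt (by norm_num)
  have hpp : ∀ i j, partialD (partialD q j) i u =
      fderiv ℝ (fderiv ℝ q) u (EuclideanSpace.single i 1) (EuclideanSpace.single j 1) := by
    intro i j
    unfold partialD
    rw [fderiv_clm_apply hd (differentiableAt_const _)]
    simp
  -- Both fundamental forms are matrices of bilinear forms; conjugating by the coordinate matrix of
  -- the `w k` evaluates these forms on the `w k`.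
  have key : ∀ (L : Plane →L[ℝ] Plane →L[ℝ] ℝ) (M : Matrix (Fin 2) (Fin 2) ℝ)
      (_ : ∀ i j, M i j = L (EuclideanSpace.single i 1) (EuclideanSpace.single j 1)) (k l : Fin 2),
      ((Matrix.of fun i k => w k i).transpose * M * Matrix.of fun i k => w k i) k l
        = L (w k) (w l) := by
    intro L M hM k l
    conv_rhs => rw [← plane_sum (w k), ← plane_sum (w l)]
    simp [Matrix.mul_apply, Fin.sum_univ_two, hM]
    ring
  unfold meanCurvature
  rw [trace_inv_mul_eq _ _ (Matrix.of fun i k => w k i)]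
  · rw [Matrix.trace]
    refine Finset.sum_congr rfl fun k _ => ?_
    rw [Matrix.diag_apply, key (-((ContinuousLinearMap.compL ℝ Plane Space ℝ (innerSL ℝ n)).comp
      (fderiv ℝ (fderiv ℝ q) u)))]
    · simp [real_inner_comm]
    · intro i j
      simp [secondForm, hpp, real_inner_comm]
  · ext k l
    rw [key ((((innerSL ℝ : Space →L[ℝ] Space →L[ℝ] ℝ).comp (fderiv ℝ q u)).flip.comp
      (fderiv ℝ q u)))]
    · simp [Matrix.one_apply, ← hw, real_inner_comm]
    · intro i j
      simp [firstForm, partialD, real_inner_comm]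

/-- A negative second derivative would make `x` a local maximum as well, so `f` would be constant
near `x` and its second derivative zero. -/
theorem second_deriv_nonneg_of_isLocalMin {f f' : ℝ → ℝ} {x c : ℝ}
    (hf : ∀ᶠ r in 𝓝 x, HasDerivAt f (f' r) r) (hf' : HasDerivAt f' c x) (hmin : IsLocalMin f x) :
    0 ≤ c := by
  by_contra! hc
  have hd : deriv f =ᶠ[𝓝 x] f' := by filter_upwards [hf] with r hr using hr.deriv
  have hdd : deriv (deriv f) x = c := by rw [hd.deriv_eq, hf'.deriv]
  have h0 : deriv f x = 0 := hmin.deriv_eq_zero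
  have hmax : IsLocalMax f x :=
    isLocalMax_of_deriv_deriv_neg (by rw [hdd]; exact hc) h0 hf.self_of_nhds.continuousAt
  have hconst : f =ᶠ[𝓝 x] fun _ => f x := by
    filter_upwards [hmin, hmax] with y h1 h2 using le_antisymm h2 h1
  have : deriv (deriv f) x = 0 := by
    have h := hconst.deriv.deriv_eq
    rw [h]; simp
  linarith

/-- If `n + b e₃` is normal with `b ≥ 0`, `n` points upwards and to the outer side, then the slope
of `n` is at most the slope of the outer normal. -/
theorem inner_e3_le_of_add_smul_eq {n M : Space} {a b : ℝ} (hn : ‖n‖ = 1) (hM : ‖M‖ = 1)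
    (hb : 0 ≤ b) (h : n + b • e3 = a • M) (hnM : 0 ≤ inner ℝ n M) (hc : 0 ≤ inner ℝ n e3) :
    inner ℝ n e3 ≤ inner ℝ M e3 := by
  have he : ‖e3‖ = 1 := by simp [e3]
  have nn : inner ℝ n n = 1 := by rw [real_inner_self_eq_norm_sq, hn]; norm_num
  have MM : inner ℝ M M = 1 := by rw [real_inner_self_eq_norm_sq, hM]; norm_num
  have ee : inner ℝ e3 e3 = 1 := by rw [real_inner_self_eq_norm_sq, he]; norm_num
  -- The vector relation is paired with `e3`, with `n` and with itself. Writing `c = n · e₃` and `m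
  -- = M · e₃`, the second pairing gives `a > 0`, the third gives `a ≤ 1 + b`, and the first gives
  -- `m ≥ 0` and `c = a m - b ≤ m - b (1 - m) ≤ m`.
  have h1 : inner ℝ n e3 + b = a * inner ℝ M e3 := by
    have := congrArg (fun v => inner ℝ v e3) h
    simpa only [inner_add_left, real_inner_smul_left, ee, mul_one] using this
  have h2 : 1 + b * inner ℝ n e3 = a * inner ℝ n M := by
    have := congrArg (fun v => inner ℝ n v) h
    simpa only [inner_add_right, real_inner_smul_right, nn] using this
  have h3 : 1 + 2 * b * inner ℝ n e3 + b ^ 2 = a ^ 2 := by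
    have := congrArg (fun v => inner ℝ v v) h
    simp only [inner_add_right, inner_add_left, real_inner_smul_right, real_inner_smul_left, nn,
      ee, MM, real_inner_comm n e3] at this
    linear_combination this
  have hc1 : inner ℝ n e3 ≤ 1 := by simpa [hn, he] using real_inner_le_norm n e3
  have hm1 : inner ℝ M e3 ≤ 1 := by simpa [hM, he] using real_inner_le_norm M e3
  have ha : 0 < a := by
    by_contra! hcon
    nlinarith [mul_nonneg hb hc]
  have hab : a ≤ 1 + b := by
    apply le_of_sq_le_sq _ (by linarith)
    nlinarith [mul_nonneg hb (sub_nonneg.2 hc1)]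
  have hm0 : 0 ≤ inner ℝ M e3 := by
    by_contra! hcon
    nlinarith [mul_neg_of_pos_of_neg ha hcon]
  nlinarith [mul_nonneg (sub_nonneg.2 hab) hm0, mul_nonneg hb (sub_nonneg.2 hm1)]

/-! ### Topological preliminaries and planar domains -/

theorem subset_or_disjoint_of_frontier {X : Type*} [TopologicalSpace X] {C E : Set X}
    (hC : IsPreconnected C) (h : Disjoint C (frontier E)) : C ⊆ E ∨ Disjoint C E := by
  have hcov : C ⊆ interior E ∪ (closure E)ᶜ := by
    intro x hx
    by_cases h1 : x ∈ closure E
    · left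
      by_contra h2
      exact h.le_bot ⟨hx, h1, h2⟩
    · right; exact h1
  have hdis : Disjoint (interior E) (closure E)ᶜ :=
    disjoint_compl_right_iff_subset.2 (interior_subset.trans subset_closure)
  rcases hC.subset_or_subset isOpen_interior isClosed_closure.isOpen_compl hdis hcov with h1 | h1
  · left; exact h1.trans interior_subset
  · right
    exact (disjoint_compl_right_iff_subset.2 subset_closure).symm.mono_left h1

theorem exists_pos_le_of_isCompact {X : Type*} [TopologicalSpace X] {K : Set X}
    (hK : IsCompact K) {f : X → ℝ} (hf : ContinuousOn f K) (h : ∀ x ∈ K, 0 < f x) :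
    ∃ δ : ℝ, 0 < δ ∧ ∀ x ∈ K, δ ≤ f x :=
  hK.exists_forall_le' hf h

theorem closure_eq_union_frontier {X : Type*} [TopologicalSpace X] (U : Set X) :
    closure U = U ∪ frontier U := closure_eq_self_union_frontier U

/-- For `u` in `U`, the open ball around `u` reaching its nearest frontier point `y` is connected
and misses the frontier, so it lies in `U`. The segment serves to carry information about the normal
from the frontier to `u`. -/
theorem exists_frontier_segment {U : Set Plane} {u x : Plane}
    (hu : u ∈ closure U) (hx : x ∈ frontier U) :
    ∃ y ∈ frontier U, segment ℝ u y ⊆ closure U ∧ dist u y ≤ dist u x := by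
  by_cases huf : u ∈ frontier U
  · exact ⟨u, huf, by simpa using hu, by simp⟩
  have huU : u ∈ U := by
    rw [closure_eq_union_frontier] at hu
    exact hu.resolve_right huf
  obtain ⟨y, hy, hd⟩ := isClosed_frontier.exists_infDist_eq_dist ⟨x, hx⟩ u
  refine ⟨y, hy, ?_, hd ▸ Metric.infDist_le_dist_of_mem hx⟩
  have hne : dist u y ≠ 0 := by
    rw [dist_ne_zero]; rintro rfl; exact huf hy
  have hball : Metric.ball u (dist u y) ⊆ U := by
    have hdisj : Disjoint (Metric.ball u (dist u y)) (frontier U) := by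
      refine Set.disjoint_left.2 fun z hz hzf => ?_
      have h1 := Metric.infDist_le_dist_of_mem (x := u) hzf
      rw [hd] at h1
      rw [Metric.mem_ball, dist_comm] at hz
      linarith
    rcases subset_or_disjoint_of_frontier (convex_ball u (dist u y)).isPreconnected hdisj
      with h | h
    · exact h
    · exact absurd huU (Set.disjoint_left.1 h (Metric.mem_ball_self (by positivity)))
  have hcb : Metric.closedBall u (dist u y) ⊆ closure U := by
    rw [← closure_ball u hne]
    exact closure_mono hball
  refine Subset.trans ?_ hcb
  exact (convex_closedBall u (dist u y)).segment_subset (Metric.mem_closedBall_self dist_nonneg)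
    (by rw [Metric.mem_closedBall, dist_comm])

theorem segment_subset_of_forall {s : Set Plane} {a b : Plane}
    (h : ∀ θ ∈ Icc (0 : ℝ) 1, a + θ • (b - a) ∈ s) : segment ℝ a b ⊆ s := by
  rw [segment_eq_image']
  rintro _ ⟨θ, hθ, rfl⟩
  exact h θ hθ

/-- Local description of the domain near a boundary point. -/
theorem IsHolderDomain.exists_chart {α : ℝ≥0} {U : Set Plane} (hU : IsHolderDomain α U)
    {x : Plane} (hx : x ∈ frontier U) :
    ∃ (φ : Plane → ℝ) (g : Plane →L[ℝ] ℝ), g ≠ 0 ∧ HasStrictFDerivAt φ g x ∧ φ x = 0 ∧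
      (∀ᶠ y in 𝓝 x, y ∈ closure U → φ y ≤ 0) ∧ (∀ᶠ y in 𝓝 x, φ y < 0 → y ∈ U) := by
  obtain ⟨r, hr, φ, hφ, -, h0, hd, heq⟩ := hU.boundary x hx
  have hb : Metric.ball x r ∈ 𝓝 x := Metric.ball_mem_nhds x hr
  have hst : HasStrictFDerivAt φ (fderiv ℝ φ x) x :=
    (hφ.contDiffAt hb).hasStrictFDerivAt (by norm_num)
  refine ⟨φ, fderiv ℝ φ x, hd, hst, h0, ?_, ?_⟩
  · filter_upwards [hb] with y hy hyU
    by_contra! hpos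
    have hc : ContinuousAt φ y :=
      (hφ.continuousOn).continuousAt (Metric.isOpen_ball.mem_nhds hy)
    have hev : ∀ᶠ z in 𝓝 y, 0 < φ z ∧ z ∈ Metric.ball x r :=
      (hc.eventually (lt_mem_nhds hpos)).and (Metric.isOpen_ball.mem_nhds hy)
    obtain ⟨z, hz, hz1, hz2⟩ := ((mem_closure_iff_frequently.1 hyU).and_eventually hev).exists
    have : z ∈ {y | φ y < 0} ∩ Metric.ball x r := heq ▸ ⟨hz, hz2⟩
    exact absurd this.1 (not_lt.2 hz1.le)
  · filter_upwards [hb] with y hy hneg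
    have : y ∈ U ∩ Metric.ball x r := heq ▸ ⟨hneg, hy⟩
    exact this.1

/-- Directions pointing strictly into the domain. -/
theorem IsHolderDomain.exists_inward {α : ℝ≥0} {U : Set Plane} (hU : IsHolderDomain α U)
    {x : Plane} (hx : x ∈ frontier U) :
    ∃ g : Plane →L[ℝ] ℝ, g ≠ 0 ∧ ∀ w, g w < 0 → ∀ᶠ r : ℝ in 𝓝[>] 0, x + r • w ∈ U := by
  obtain ⟨φ, g, hg, hst, h0, -, hin⟩ := hU.exists_chart hx
  refine ⟨g, hg, fun w hw => ?_⟩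
  have hline : HasDerivAt (fun r : ℝ => φ (x + r • w)) (g w) 0 := by
    have h1 : HasDerivAt (fun r : ℝ => x + r • w) w 0 := by
      simpa using ((hasDerivAt_id (0 : ℝ)).smul_const w).const_add x
    have h2 : HasFDerivAt φ g (x + (0 : ℝ) • w) := by simpa using hst.hasFDerivAt
    exact h2.comp_hasDerivAt 0 h1
  have hcont : Tendsto (fun r : ℝ => x + r • w) (𝓝[>] 0) (𝓝 x) := by
    have : Continuous fun r : ℝ => x + r • w := by fun_prop
    simpa using (this.tendsto 0).mono_left nhdsWithin_le_nhds
  have hsl := hline.tendsto_slope.mono_left (nhdsWithin_mono 0 (fun r (hr : 0 < r) => hr.ne'))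
  filter_upwards [hsl.eventually (gt_mem_nhds hw), hcont.eventually hin, self_mem_nhdsWithin]
    with r h1 h2 hr
  apply h2
  have hr : 0 < r := hr
  simp only [slope_def_field, zero_smul, add_zero, h0, sub_zero] at h1
  simpa using (div_lt_iff₀ hr).1 h1

/-- Nearby points of the closure of the domain are joined by a path of three segments. -/
theorem IsHolderDomain.exists_path {α : ℝ≥0} {U : Set Plane} (hU : IsHolderDomain α U)
    {x : Plane} (hx : x ∈ closure U) :
    ∃ C : ℝ, 0 < C ∧ ∀ ρ : ℝ, 0 < ρ → ∃ r : ℝ, 0 < r ∧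
      ∀ u ∈ closure U ∩ Metric.ball x r, ∀ v ∈ closure U ∩ Metric.ball x r, ∃ a b : Plane,
        segment ℝ u a ⊆ closure U ∩ Metric.ball x ρ ∧ segment ℝ a b ⊆ closure U ∩ Metric.ball x ρ ∧
        segment ℝ b v ⊆ closure U ∩ Metric.ball x ρ ∧
        ‖a - u‖ ≤ C * ‖v - u‖ ∧ ‖b - a‖ ≤ C * ‖v - u‖ ∧ ‖v - b‖ ≤ C * ‖v - u‖ := by
  by_cases hxU : x ∈ U
  · obtain ⟨r₀, hr₀, hball⟩ := Metric.isOpen_iff.1 hU.isOpen x hxU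
    refine ⟨1, one_pos, fun ρ hρ => ⟨min r₀ ρ, lt_min hr₀ hρ, fun u hu v hv => ⟨u, u, ?_⟩⟩⟩
    have hsub : Metric.ball x (min r₀ ρ) ⊆ closure U ∩ Metric.ball x ρ := fun y hy =>
      ⟨subset_closure (hball (Metric.ball_subset_ball (min_le_left _ _) hy)),
        Metric.ball_subset_ball (min_le_right _ _) hy⟩
    refine ⟨by simpa using hsub hu.2, by simpa using hsub hu.2,
      ((convex_ball x _).segment_subset hu.2 hv.2).trans hsub, by simp, by simp, by simp⟩
  · have hxf : x ∈ frontier U := by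
      rw [closure_eq_union_frontier] at hx
      exact hx.resolve_left hxU
    obtain ⟨φ, g, hg, hst, h0, hcl, hin⟩ := hU.exists_chart hxf
    obtain ⟨w₁, hw₁⟩ : ∃ w, g w ≠ 0 := by
      by_contra! hc
      exact hg (ContinuousLinearMap.ext hc)
    obtain ⟨e, he⟩ : ∃ w, g w = -1 := ⟨(-(g w₁)⁻¹) • w₁, by simp [hw₁]⟩
    -- `η` bounds the relative error of replacing `φ` by its differential `g`. A move by `s • e`
    -- lowers `g` by `s` and costs an error of at most `s / 2`, so it leads into the domain.
    obtain ⟨η, hη, hηe⟩ : ∃ η : ℝ, 0 < η ∧ η * ‖e‖ ≤ 1 / 2 := by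
      refine ⟨1 / (2 * (‖e‖ + 1)), by positivity, ?_⟩
      rw [div_mul_eq_mul_div, one_mul, div_le_div_iff₀ (by positivity) (by norm_num)]
      nlinarith [norm_nonneg e]
    have hst' := hst.isLittleO.def hη
    rw [Filter.eventually_iff] at hst'
    obtain ⟨ρ₁, hρ₁, hlip⟩ : ∃ ρ₁ > 0, ∀ y ∈ Metric.ball x ρ₁, ∀ z ∈ Metric.ball x ρ₁,
        |φ y - φ z - g (y - z)| ≤ η * ‖y - z‖ := by
      rw [Metric.mem_nhds_iff] at hst'
      obtain ⟨ρ₁, hρ₁, hs⟩ := hst'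
      refine ⟨ρ₁, hρ₁, fun y hy z hz => ?_⟩
      have := @hs (y, z) (by rw [← ball_prod_same]; exact ⟨hy, hz⟩)
      simpa using this
    obtain ⟨ρ₂, hρ₂, hcl⟩ := Metric.eventually_nhds_iff_ball.1 hcl
    obtain ⟨ρ₃, hρ₃, hin⟩ := Metric.eventually_nhds_iff_ball.1 hin
    -- The path goes inward by `s = L ‖v - u‖`, across parallel to `v - u`, and back. With this `L`,
    -- `s / 2` exceeds `(‖g‖ + η) ‖v - u‖`, the most that the crossing can add to `φ`.
    set L : ℝ := 2 * (‖g‖ + η + 1) with hL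
    have hLpos : 0 < L := by positivity
    set C : ℝ := L * ‖e‖ + 1 with hC
    have hCpos : 0 < C := by positivity
    refine ⟨C, hCpos, fun ρ hρ => ?_⟩
    set R := min (min ρ₁ ρ₂) (min ρ₃ ρ) with hR
    have hRpos : 0 < R := lt_min (lt_min hρ₁ hρ₂) (lt_min hρ₃ hρ)
    have hR1 : R ≤ ρ₁ := (min_le_left _ _).trans (min_le_left _ _)
    have hR2 : R ≤ ρ₂ := (min_le_left _ _).trans (min_le_right _ _)
    have hR3 : R ≤ ρ₃ := (min_le_right _ _).trans (min_le_left _ _)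
    have hR4 : R ≤ ρ := (min_le_right _ _).trans (min_le_right _ _)
    -- Since `‖v - u‖ < 2 r`, shifts of length at most `C ‖v - u‖` stay within `r + 2 C r < R` of
    -- `x`.
    set r := R / (2 * C + 2) with hr
    have hrpos : 0 < r := by positivity
    have hrR : r + C * (2 * r) < R := by
      have h1 : r * (2 * C + 2) = R := by rw [hr]; field_simp
      linarith
    have hrR' : r ≤ R := by nlinarith [mul_pos hCpos hrpos]
    refine ⟨r, hrpos, fun u hu v hv => ?_⟩
    set s : ℝ := L * ‖v - u‖ with hs
    have hs0 : 0 ≤ s := by positivity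
    have hvu : ‖v - u‖ < 2 * r := by
      have h1 := hu.2
      have h2 := hv.2
      rw [Metric.mem_ball] at h1 h2
      have := dist_triangle_right v u x
      rw [dist_eq_norm v u] at this
      linarith
    have hse : s * ‖e‖ ≤ C * ‖v - u‖ := by
      rw [hs, hC]; nlinarith [norm_nonneg (v - u)]
    have hmem : ∀ z ∈ closure U ∩ Metric.ball x r, ∀ d : Plane, ‖d‖ ≤ C * ‖v - u‖ →
        z + d ∈ Metric.ball x R := by
      intro z hz d hd
      have h1 := hz.2
      rw [Metric.mem_ball, dist_eq_norm] at h1 ⊢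
      calc ‖z + d - x‖ = ‖(z - x) + d‖ := by congr 1; abel
        _ ≤ ‖z - x‖ + ‖d‖ := norm_add_le _ _
        _ < R := by nlinarith
    have hneg : ∀ z ∈ closure U ∩ Metric.ball x r, ∀ d : Plane, ‖d‖ ≤ C * ‖v - u‖ →
        g d + η * ‖d‖ < 0 → z + d ∈ closure U ∩ Metric.ball x ρ := by
      intro z hz d hd hgd
      have h1 := hmem z hz d hd
      have h2 := hlip (z + d) (Metric.ball_subset_ball hR1 h1) z
        (Metric.ball_subset_ball (hrR'.trans hR1) hz.2)
      have h3 := hcl z (Metric.ball_subset_ball (hrR'.trans hR2) hz.2) hz.1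
      rw [add_sub_cancel_left] at h2
      have h4 := (abs_le.1 h2).2
      exact ⟨subset_closure (hin _ (Metric.ball_subset_ball hR3 h1) (by linarith)),
        Metric.ball_subset_ball hR4 h1⟩
    have hself : ∀ z ∈ closure U ∩ Metric.ball x r, z ∈ closure U ∩ Metric.ball x ρ :=
      fun z hz => ⟨hz.1, Metric.ball_subset_ball (hrR'.trans hR4) hz.2⟩
    have hup : ∀ z ∈ closure U ∩ Metric.ball x r, ∀ θ ∈ Icc (0 : ℝ) 1,
        z + (θ * s) • e ∈ closure U ∩ Metric.ball x ρ := by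
      intro z hz θ hθ
      rcases (mul_nonneg hθ.1 hs0).eq_or_lt with h | h
      · rw [← h, zero_smul, add_zero]; exact hself z hz
      · have hd : ‖(θ * s) • e‖ = θ * s * ‖e‖ := by rw [norm_smul, Real.norm_of_nonneg h.le]
        refine hneg z hz _ ?_ ?_
        · rw [hd]
          have : θ * s ≤ s := mul_le_of_le_one_left hs0 hθ.2
          nlinarith [norm_nonneg e]
        · rw [hd, map_smul, he, smul_eq_mul]
          nlinarith
    have hacross : ∀ θ ∈ Icc (0 : ℝ) 1,
        u + s • e + θ • (v - u) ∈ closure U ∩ Metric.ball x ρ := by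
      intro θ hθ
      rcases (norm_nonneg (v - u)).eq_or_lt with h | h
      · have h1 : s = 0 := by rw [hs, ← h, mul_zero]
        have h2 : v - u = 0 := norm_eq_zero.1 h.symm
        rw [h1, h2, zero_smul, smul_zero, add_zero, add_zero]; exact hself u hu
      · have h1 : ‖θ • (v - u)‖ ≤ ‖v - u‖ := by
          rw [norm_smul, Real.norm_of_nonneg hθ.1]
          exact mul_le_of_le_one_left h.le hθ.2
        have hd : ‖s • e + θ • (v - u)‖ ≤ s * ‖e‖ + ‖v - u‖ := by
          refine (norm_add_le _ _).trans ?_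
          rw [norm_smul, Real.norm_of_nonneg hs0]; linarith
        have h2 : g (θ • (v - u)) ≤ ‖g‖ * ‖v - u‖ :=
          (le_abs_self _).trans ((g.le_opNorm _).trans (by gcongr))
        rw [add_assoc]
        refine hneg u hu _ (hd.trans (by rw [hs, hC]; linarith)) ?_
        rw [map_add, map_smul, he, smul_eq_mul]
        have h3 : η * ‖s • e + θ • (v - u)‖ ≤ s / 2 + η * ‖v - u‖ := by nlinarith
        have h4 : s = 2 * (‖g‖ * ‖v - u‖) + 2 * (η * ‖v - u‖) + 2 * ‖v - u‖ := by rw [hs, hL]; ring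
        linarith
    refine ⟨u + s • e, v + s • e, ?_, ?_, ?_, ?_, ?_, ?_⟩
    · refine segment_subset_of_forall fun θ hθ => ?_
      have := hup u hu θ hθ
      rwa [add_sub_cancel_left, smul_smul]
    · refine segment_subset_of_forall fun θ hθ => ?_
      have := hacross θ hθ
      rwa [add_sub_add_right_eq_sub]
    · rw [segment_symm]
      refine segment_subset_of_forall fun θ hθ => ?_
      have := hup v hv θ hθ
      rwa [add_sub_cancel_left, smul_smul]
    · rwa [add_sub_cancel_left, norm_smul, Real.norm_of_nonneg hs0]
    · rw [add_sub_add_right_eq_sub]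
      nlinarith [norm_nonneg (v - u), mul_nonneg hLpos.le (norm_nonneg e)]
    · rwa [sub_add_cancel_left, norm_neg, norm_smul, Real.norm_of_nonneg hs0]

/-! ### Evolutions parametrized over a fixed time interval -/

/-- The data of a smooth flow on a fixed time interval `[0, S]`. -/
structure IsEvolution (S s : ℝ) (β : Plane → ℝ) (E : ℝ → Set Space) (α : ℝ≥0) (U : Set Plane)
    (p N : ℝ → Plane → Space) : Prop where
  pos : 0 < S
  domain : IsHolderDomain α U
  parabolic : IsParabolicClass α S U p
  param : ∀ t ∈ Icc 0 S, IsParametrization α U (p t) (innerBoundary (E t))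
  normal : ∀ t ∈ Icc 0 S, IsOuterNormal U (p t) (E t) (N t)
  contact : ∀ t ∈ Icc 0 S, ∀ u ∈ frontier U, inner ℝ (N t u) e3 = - β (toPlane (p t u))
  law : ∀ t ∈ Ioo 0 S, ∀ u ∈ U,
    inner ℝ (deriv (fun τ => p τ u) t) (N t u) = - meanCurvature (p t) (N t u) u + s
  droplet : ∀ t ∈ Icc 0 S, IsDroplet (E t)
  angle : IsContactAngle β

variable {S s : ℝ} {β : Plane → ℝ} {E : ℝ → Set Space} {α : ℝ≥0} {U : Set Plane}
  {p N : ℝ → Plane → Space}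

theorem convex_halfSpace : Convex ℝ halfSpace := by
  have : halfSpace = {x : Space | 0 < (EuclideanSpace.proj 2 : Space →L[ℝ] ℝ) x} := by
    ext x; simp [halfSpace]
  rw [this]
  exact convex_halfSpace_gt (EuclideanSpace.proj 2 : Space →L[ℝ] ℝ).isLinear 0

theorem continuous_height : Continuous fun x : Space => x 2 :=
  (EuclideanSpace.proj 2 : Space →L[ℝ] ℝ).continuous

theorem isOpen_halfSpace : IsOpen halfSpace := isOpen_lt continuous_const continuous_height

theorem inner_e3 (x : Space) : inner ℝ x e3 = x 2 := by
  simp [e3, EuclideanSpace.inner_single_right]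

theorem norm_e3 : ‖e3‖ = 1 := by simp [e3]

namespace IsEvolution

theorem isCompact_closure (h : IsEvolution S s β E α U p N) : IsCompact (closure U) :=
  h.domain.bounded.isCompact_closure

theorem continuousOn (h : IsEvolution S s β E α U p N) {t : ℝ} (ht : t ∈ Icc 0 S) :
    ContinuousOn (p t) (closure U) := (h.param t ht).contDiffOn.continuousOn

theorem continuousOn_time (h : IsEvolution S s β E α U p N) {u : Plane} (hu : u ∈ closure U) :
    ContinuousOn (fun t => p t u) (Icc 0 S) :=
  (h.parabolic.time_differentiable u hu).continuousOn

theorem hasFDerivWithinAt (h : IsEvolution S s β E α U p N) {t : ℝ} (ht : t ∈ Icc 0 S)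
    {u : Plane} (hu : u ∈ closure U) :
    HasFDerivWithinAt (p t) (fderivWithin ℝ (p t) (closure U) u) (closure U) u :=
  ((h.param t ht).contDiffOn.differentiableOn (by norm_num) u hu).hasFDerivWithinAt

theorem isCompact_image (h : IsEvolution S s β E α U p N) {t : ℝ} (ht : t ∈ Icc 0 S) :
    IsCompact (p t '' closure U) := h.isCompact_closure.image_of_continuousOn (h.continuousOn ht)

theorem closure_innerBoundary (h : IsEvolution S s β E α U p N) {t : ℝ} (ht : t ∈ Icc 0 S) :
    closure (innerBoundary (E t)) = p t '' closure U := by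
  rw [closure_eq_union_frontier U, image_union, (h.param t ht).image_interior,
    (h.param t ht).image_boundary]
  exact (union_sdiff_cancel subset_closure).symm

theorem halfSpace_inter_image (h : IsEvolution S s β E α U p N) {t : ℝ} (ht : t ∈ Icc 0 S) :
    halfSpace ∩ p t '' closure U = innerBoundary (E t) := by
  refine Subset.antisymm ?_ fun x hx =>
    ⟨hx.1, h.closure_innerBoundary ht ▸ subset_closure hx⟩
  rintro _ ⟨hx, u, hu, rfl⟩
  rw [closure_eq_union_frontier] at hu
  rcases hu with hu | hu
  · rw [← (h.param t ht).image_interior]; exact ⟨u, hu, rfl⟩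
  · exact absurd ((h.param t ht).height_zero u hu) (ne_of_gt hx)

theorem height_nonneg (h : IsEvolution S s β E α U p N) {t : ℝ} (ht : t ∈ Icc 0 S)
    {u : Plane} (hu : u ∈ closure U) : 0 ≤ p t u 2 := by
  rw [closure_eq_union_frontier] at hu
  rcases hu with hu | hu
  · exact ((h.param t ht).height_pos u hu).le
  · exact ((h.param t ht).height_zero u hu).ge

theorem mem_halfSpace (h : IsEvolution S s β E α U p N) {t : ℝ} (ht : t ∈ Icc 0 S)
    {u : Plane} (hu : u ∈ U) : p t u ∈ halfSpace := (h.param t ht).height_pos u hu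

theorem mem_innerBoundary (h : IsEvolution S s β E α U p N) {t : ℝ} (ht : t ∈ Icc 0 S)
    {u : Plane} (hu : u ∈ U) : p t u ∈ innerBoundary (E t) :=
  (h.param t ht).image_interior ▸ mem_image_of_mem _ hu

/-- Connected subsets of the half-space which avoid the surface lie on one side of it. -/
theorem subset_or_disjoint (h : IsEvolution S s β E α U p N) {t : ℝ} (ht : t ∈ Icc 0 S)
    {C : Set Space} (hC : IsPreconnected C) (hCΩ : C ⊆ halfSpace)
    (hd : ∀ x ∈ C, x ∉ p t '' closure U) : C ⊆ E t ∨ Disjoint C (E t) := by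
  refine subset_or_disjoint_of_frontier hC (Set.disjoint_left.2 fun x hx hxf => hd x hx ?_)
  have : x ∈ innerBoundary (E t) := ⟨hCΩ hx, hxf⟩
  rw [← h.halfSpace_inter_image ht] at this
  exact this.2

/-- If `p τ u` is close to `p t v` and `τ` is close to `t`, then `u` is close to `v`. -/
theorem exists_dist_lt (h : IsEvolution S s β E α U p N) {t : ℝ} (ht : t ∈ Icc 0 S)
    {v : Plane} (hv : v ∈ closure U) {r : ℝ} (hr : 0 < r) :
    ∃ ρ : ℝ, 0 < ρ ∧ ∀ τ ∈ Icc 0 S, |τ - t| < ρ → ∀ u ∈ closure U, dist (p τ u) (p t v) < ρ →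
      dist u v < r := by
  -- On the compact set of `(τ, u)` with `u` at distance at least `r` from `v`, the sum of the time
  -- gap and the space gap is positive by injectivity of `p t`, hence bounded below.
  have hZ : IsCompact ((Icc 0 S ×ˢ closure U) ∩ {z : ℝ × Plane | r ≤ dist z.2 v}) :=
    (isCompact_Icc.prod h.isCompact_closure).inter_right
      (isClosed_le continuous_const (by fun_prop))
  have hf : ContinuousOn (fun z : ℝ × Plane => |z.1 - t| + dist (p z.1 z.2) (p t v))
      ((Icc 0 S ×ˢ closure U) ∩ {z : ℝ × Plane | r ≤ dist z.2 v}) := by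
    refine ContinuousOn.add (by fun_prop) ?_
    exact continuous_dist.comp_continuousOn
      ((h.parabolic.continuousOn.mono inter_subset_left).prodMk continuousOn_const)
  obtain ⟨δ, hδ, hle⟩ := exists_pos_le_of_isCompact hZ hf (by
    rintro ⟨τ, u⟩ ⟨⟨hτ, hu⟩, hru⟩
    change r ≤ dist u v at hru
    by_contra! hcon
    have h1 : |τ - t| = 0 := by
      linarith [abs_nonneg (τ - t), dist_nonneg (x := p τ u) (y := p t v)]
    have h2 : dist (p τ u) (p t v) = 0 := by
      linarith [abs_nonneg (τ - t), dist_nonneg (x := p τ u) (y := p t v)]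
    have h3 : τ = t := sub_eq_zero.1 (abs_eq_zero.1 h1)
    subst h3
    have := (h.param τ ht).injOn hu hv (dist_eq_zero.1 h2)
    change u = v at this
    rw [this, dist_self] at hru
    linarith)
  refine ⟨δ / 2, by positivity, fun τ hτ h1 u hu h2 => ?_⟩
  by_contra! hcon
  have := hle (τ, u) ⟨⟨hτ, hu⟩, hcon⟩
  simp only at this
  linarith

/-- Chords of the surfaces near a point are almost orthogonal to the normal at this point,
uniformly for nearby times. -/
theorem exists_chord_bound (h : IsEvolution S s β E α U p N) {t : ℝ} (ht : t ∈ Icc 0 S)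
    {v : Plane} (hv : v ∈ closure U) {c : ℝ} (hc : 0 < c) :
    ∃ ρ : ℝ, 0 < ρ ∧ ∀ τ ∈ Icc 0 S, |τ - t| < ρ →
      ∀ x ∈ p τ '' closure U, ∀ y ∈ p τ '' closure U, dist x (p t v) < ρ → dist y (p t v) < ρ →
        |inner ℝ (x - y) (N t v)| ≤ c * ‖x - y‖ := by
  set A := fderivWithin ℝ (p t) (closure U) v with hA
  have hinj : Function.Injective A := (h.param t ht).immersion v hv
  have hN : ‖N t v‖ = 1 := (h.normal t ht).norm_eq_one v hv
  have hAN : ∀ w, inner ℝ (A w) (N t v) = 0 := (h.normal t ht).orthogonal v hv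
  obtain ⟨K, hK, hanti⟩ := (A : Plane →ₗ[ℝ] Space).exists_antilipschitzWith
    (LinearMap.ker_eq_bot.2 hinj)
  obtain ⟨m, hm, hmA⟩ : ∃ m : ℝ, 0 < m ∧ ∀ w, m * ‖w‖ ≤ ‖A w‖ := by
    refine ⟨(K : ℝ)⁻¹, by positivity, fun w => ?_⟩
    have := hanti.le_mul_dist w 0
    simp only [map_zero, dist_zero_right] at this
    rw [inv_mul_le_iff₀ (by exact_mod_cast hK)]
    exact this
  obtain ⟨C, hC, hpath⟩ := h.domain.exists_path hv
  -- If `p τ` differs from `A` by at most `κ ‖u - u'‖` on increments, chords have length at least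
  -- `(m - κ) ‖u - u'‖` and normal component at most `κ ‖u - u'‖`; this `κ` makes the quotient at
  -- most `c`. The tolerance `κ / (3 * C)` on the derivative accounts for three segments, each of
  -- length at most `C ‖u - u'‖`.
  set κ := min (m / 2) (c * m / 2) with hκ
  have hκpos : 0 < κ := lt_min (by positivity) (by positivity)
  have hκ1 : κ ≤ m / 2 := min_le_left _ _
  have hκ2 : κ ≤ c * m / 2 := min_le_right _ _
  obtain ⟨ρ₁, hρ₁, hder⟩ : ∃ ρ₁ > 0, ∀ τ ∈ Icc 0 S, |τ - t| < ρ₁ → ∀ u ∈ closure U,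
      dist u v < ρ₁ → ‖fderivWithin ℝ (p τ) (closure U) u - A‖ ≤ κ / (3 * C) := by
    have := Metric.continuousWithinAt_iff.1 (h.parabolic.continuousOn_fderiv (t, v) ⟨ht, hv⟩)
      (κ / (3 * C)) (by positivity)
    obtain ⟨ρ₁, hρ₁, hs⟩ := this
    refine ⟨ρ₁, hρ₁, fun τ hτ h1 u hu h2 => ?_⟩
    have := hs (x := (τ, u)) ⟨hτ, hu⟩ (by
      rw [Prod.dist_eq]; exact max_lt (by rwa [Real.dist_eq]) h2)
    rw [dist_eq_norm] at this
    exact this.le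
  obtain ⟨r, hr, hpath⟩ := hpath ρ₁ hρ₁
  obtain ⟨ρ₂, hρ₂, hloc⟩ := h.exists_dist_lt ht hv hr
  refine ⟨min ρ₁ ρ₂, lt_min hρ₁ hρ₂, ?_⟩
  rintro τ hτ hτt _ ⟨u, hu, rfl⟩ _ ⟨u', hu', rfl⟩ hd hd'
  have hu1 := hloc τ hτ (hτt.trans_le (min_le_right _ _)) u hu (hd.trans_le (min_le_right _ _))
  have hu2 := hloc τ hτ (hτt.trans_le (min_le_right _ _)) u' hu' (hd'.trans_le (min_le_right _ _))
  obtain ⟨a, b, s1, s2, s3, n1, n2, n3⟩ := hpath u' ⟨hu', hu2⟩ u ⟨hu, hu1⟩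
  have hmv : ∀ x y : Plane, segment ℝ x y ⊆ closure U ∩ Metric.ball v ρ₁ →
      ‖y - x‖ ≤ C * ‖u - u'‖ → ‖p τ y - p τ x - A (y - x)‖ ≤ κ / 3 * ‖u - u'‖ := by
    intro x y hs hn
    have := (convex_segment x y).norm_image_sub_le_of_norm_hasFDerivWithin_le' (φ := A)
      (C := κ / (3 * C)) (f := p τ)
      (fun z hz => (h.hasFDerivWithinAt hτ (hs hz).1).mono fun z hz => (hs hz).1)
      (fun z hz => hder τ hτ (hτt.trans_le (min_le_left _ _)) z (hs hz).1 (hs hz).2)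
      (left_mem_segment ℝ x y) (right_mem_segment ℝ x y)
    refine this.trans ?_
    calc κ / (3 * C) * ‖y - x‖ ≤ κ / (3 * C) * (C * ‖u - u'‖) := by gcongr
      _ = κ / 3 * ‖u - u'‖ := by field_simp
  have hmain : ‖p τ u - p τ u' - A (u - u')‖ ≤ κ * ‖u - u'‖ := by
    have e : p τ u - p τ u' - A (u - u') = (p τ a - p τ u' - A (a - u')) +
        (p τ b - p τ a - A (b - a)) + (p τ u - p τ b - A (u - b)) := by
      simp only [map_sub]; abel
    rw [e]
    refine (norm_add₃_le).trans ?_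
    linarith [hmv _ _ s1 n1, hmv _ _ s2 n2, hmv _ _ s3 n3]
  have hlow : (m - κ) * ‖u - u'‖ ≤ ‖p τ u - p τ u'‖ := by
    have h1 := norm_sub_norm_le (A (u - u')) (A (u - u') - (p τ u - p τ u'))
    rw [sub_sub_cancel, norm_sub_rev (A (u - u'))] at h1
    have := hmA (u - u')
    linarith
  have hup : |inner ℝ (p τ u - p τ u') (N t v)| ≤ κ * ‖u - u'‖ := by
    have e : inner ℝ (p τ u - p τ u') (N t v)
        = inner ℝ (p τ u - p τ u' - A (u - u')) (N t v) := by
      rw [inner_sub_left _ (A (u - u')), hAN, sub_zero]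
    rw [e]
    refine (abs_real_inner_le_norm _ _).trans ?_
    rwa [hN, mul_one]
  refine hup.trans (le_trans ?_ (mul_le_mul_of_nonneg_left hlow hc.le))
  have : κ ≤ c * (m - κ) := by nlinarith
  nlinarith [norm_nonneg (u - u')]

end IsEvolution

/-! ### The two sides of the surface -/

theorem convex_cone (x n : Space) {c : ℝ} (hc : 0 ≤ c) :
    Convex ℝ {y : Space | c * ‖y - x‖ < inner ℝ (y - x) n} := by
  intro y hy z hz a b ha hb hab
  have e : a • y + b • z - x = a • (y - x) + b • (z - x) := by
    rw [smul_sub, smul_sub, sub_add_sub_comm, ← add_smul, hab, one_smul]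
  have h1 : c * ‖y - x‖ < inner ℝ (y - x) n := hy
  have h2 : c * ‖z - x‖ < inner ℝ (z - x) n := hz
  change c * ‖a • y + b • z - x‖ < inner ℝ (a • y + b • z - x) n
  rw [e, inner_add_left, real_inner_smul_left, real_inner_smul_left]
  have h3 : ‖a • (y - x) + b • (z - x)‖ ≤ a * ‖y - x‖ + b * ‖z - x‖ := by
    refine (norm_add_le _ _).trans ?_
    rw [norm_smul, norm_smul, Real.norm_of_nonneg ha, Real.norm_of_nonneg hb]
  have h4 := mul_le_mul_of_nonneg_left h3 hc
  rcases ha.eq_or_lt with h0 | h0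
  · have : b = 1 := by linarith
    subst this
    rw [← h0] at h4 ⊢
    linarith
  · nlinarith [mul_lt_mul_of_pos_left h1 h0, mul_le_mul_of_nonneg_left h2.le hb]

namespace IsEvolution

/-- A truncated cone with apex on the surface and transversal axis lies on one side. -/
theorem cone_alternative (h : IsEvolution S s β E α U p N) {t : ℝ} (ht : t ∈ Icc 0 S)
    {u : Plane} (hu : u ∈ U) {x₀ n : Space} {ρ c : ℝ} (hc : 0 ≤ c)
    (hchord : ∀ x ∈ p t '' closure U, ∀ y ∈ p t '' closure U, dist x x₀ < ρ → dist y x₀ < ρ →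
      |inner ℝ (x - y) n| ≤ c * ‖x - y‖) (hux : dist (p t u) x₀ < ρ)
    {M : Space} (hM : c * ‖M‖ < inner ℝ M n) :
    ∃ C : Set Space, (C ⊆ E t ∨ Disjoint C (E t)) ∧
      (∀ w ∈ halfSpace, dist w x₀ < ρ → c * ‖w - p t u‖ < inner ℝ (w - p t u) n → w ∈ C) ∧
      ∀ᶠ ε : ℝ in 𝓝[>] 0, p t u + ε • M ∈ C := by
  refine ⟨halfSpace ∩ Metric.ball x₀ ρ ∩
    {y : Space | c * ‖y - p t u‖ < inner ℝ (y - p t u) n}, ?_, ?_, ?_⟩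
  · refine h.subset_or_disjoint ht ?_ (fun x hx => hx.1.1) ?_
    · exact ((convex_halfSpace.inter (convex_ball _ _)).inter (convex_cone _ _ hc)).isPreconnected
    · rintro x ⟨⟨_, hx1⟩, hx2⟩ hxK
      have := hchord x hxK (p t u) ⟨u, subset_closure hu, rfl⟩ hx1 hux
      have hx2 : c * ‖x - p t u‖ < inner ℝ (x - p t u) n := hx2
      linarith [le_abs_self (inner ℝ (x - p t u) n)]
  · exact fun w h1 h2 h3 => ⟨⟨h1, h2⟩, h3⟩
  · have ho : IsOpen (halfSpace ∩ Metric.ball x₀ ρ) := isOpen_halfSpace.inter Metric.isOpen_ball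
    have hcont : Tendsto (fun ε : ℝ => p t u + ε • M) (𝓝[>] 0) (𝓝 (p t u)) := by
      have : Continuous fun ε : ℝ => p t u + ε • M := by fun_prop
      simpa using (this.tendsto 0).mono_left nhdsWithin_le_nhds
    filter_upwards [hcont.eventually (ho.mem_nhds ⟨h.mem_halfSpace ht hu, hux⟩),
      self_mem_nhdsWithin] with ε h1 (hε : 0 < ε)
    refine ⟨h1, ?_⟩
    change c * ‖p t u + ε • M - p t u‖ < inner ℝ (p t u + ε • M - p t u) n
    rw [add_sub_cancel_left, norm_smul, real_inner_smul_left, Real.norm_of_nonneg hε.le]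
    nlinarith

/-- Each nappe of the cone lies on one side by `cone_alternative`, and the points `p t u ± ε • N t
u` tell which. The apex must be an interior point, since only there is the normal known to be outer.
-/
theorem side_of_cone (h : IsEvolution S s β E α U p N) {t : ℝ} (ht : t ∈ Icc 0 S)
    {u : Plane} (hu : u ∈ U) {x₀ n : Space} {ρ c : ℝ} (hc : 0 ≤ c)
    (hchord : ∀ x ∈ p t '' closure U, ∀ y ∈ p t '' closure U, dist x x₀ < ρ → dist y x₀ < ρ →
      |inner ℝ (x - y) n| ≤ c * ‖x - y‖) (hux : dist (p t u) x₀ < ρ)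
    (hN : c < inner ℝ (N t u) n) {w : Space} (hw : w ∈ halfSpace) (hwx : dist w x₀ < ρ) :
    (c * ‖w - p t u‖ < inner ℝ (w - p t u) n → w ∉ E t) ∧
      (c * ‖w - p t u‖ < -inner ℝ (w - p t u) n → w ∈ E t) := by
  have hN1 := (h.normal t ht).norm_eq_one u (subset_closure hu)
  have hout := (h.normal t ht).outer u hu
  constructor
  · intro hwn
    obtain ⟨C, hC, hC1, hC2⟩ := h.cone_alternative ht hu hc hchord hux (M := N t u)
      (by rwa [hN1, mul_one])
    obtain ⟨ε, h1, h2⟩ := (hC2.and hout).exists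
    rcases hC with hC | hC
    · exact absurd (hC h1) h2.1
    · exact Set.disjoint_left.1 hC (hC1 w hw hwx hwn)
  · intro hwn
    obtain ⟨C, hC, hC1, hC2⟩ := h.cone_alternative ht hu hc (n := -n)
      (by simpa only [inner_neg_right, abs_neg] using hchord) hux (M := -N t u)
      (by rwa [norm_neg, hN1, mul_one, inner_neg_neg])
    obtain ⟨ε, h1, h2⟩ := (hC2.and hout).exists
    rw [smul_neg, ← sub_eq_add_neg] at h1
    rcases hC with hC | hC
    · exact hC (hC1 w hw hwx (by rwa [inner_neg_right]))
    · exact absurd h2.2 (Set.disjoint_left.1 hC h1)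

/-- The normal at a point of the closed surface separates the two sides. -/
theorem side_of_normal (h : IsEvolution S s β E α U p N) {t : ℝ} (ht : t ∈ Icc 0 S)
    {v : Plane} (hv : v ∈ closure U) {c : ℝ} (hc : 0 < c) (hc1 : c < 1) :
    ∃ ρ : ℝ, 0 < ρ ∧ ∀ w ∈ halfSpace, dist w (p t v) < ρ →
      (c * ‖w - p t v‖ < inner ℝ (w - p t v) (N t v) → w ∉ E t) ∧
      (c * ‖w - p t v‖ < -inner ℝ (w - p t v) (N t v) → w ∈ E t) := by
  obtain ⟨ρ, hρ, hch⟩ := h.exists_chord_bound ht hv hc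
  refine ⟨ρ, hρ, fun w hw hwx => ?_⟩
  -- The point `v` may lie on the frontier. The cone conditions are strict, so they persist when the
  -- apex is moved to `p t u` with `u ∈ U` close to `v`.
  have hp : Tendsto (p t) (𝓝[U] v) (𝓝 (p t v)) :=
    (h.continuousOn ht v hv).mono_left (nhdsWithin_mono v subset_closure)
  have hNt : Tendsto (N t) (𝓝[U] v) (𝓝 (N t v)) :=
    ((h.normal t ht).continuousOn v hv).mono_left (nhdsWithin_mono v subset_closure)
  have hne : (𝓝[U] v).NeBot := mem_closure_iff_nhdsWithin_neBot.1 hv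
  have hNN : inner ℝ (N t v) (N t v) = 1 := by
    rw [real_inner_self_eq_norm_sq, (h.normal t ht).norm_eq_one v hv]; norm_num
  have e1 : ∀ᶠ u in 𝓝[U] v, c < inner ℝ (N t u) (N t v) :=
    (hNt.inner tendsto_const_nhds).eventually (lt_mem_nhds (by rwa [hNN]))
  have e2 : ∀ᶠ u in 𝓝[U] v, dist (p t u) (p t v) < ρ :=
    hp.eventually (Metric.ball_mem_nhds _ hρ)
  have t1 : Tendsto (fun u => c * ‖w - p t u‖) (𝓝[U] v) (𝓝 (c * ‖w - p t v‖)) :=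
    ((tendsto_const_nhds.sub hp).norm).const_mul c
  have t2 : Tendsto (fun u => inner ℝ (w - p t u) (N t v)) (𝓝[U] v)
      (𝓝 (inner ℝ (w - p t v) (N t v))) := (tendsto_const_nhds.sub hp).inner tendsto_const_nhds
  have hch' := hch t ht (by simpa using hρ)
  constructor
  · intro hwn
    obtain ⟨u, ⟨⟨h1, h2⟩, h3⟩, hu⟩ :=
      (((e1.and e2).and (t1.eventually_lt t2 hwn)).and self_mem_nhdsWithin).exists
    exact (h.side_of_cone ht hu hc.le hch' h2 h1 hw hwx).1 h3
  · intro hwn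
    obtain ⟨u, ⟨⟨h1, h2⟩, h3⟩, hu⟩ :=
      (((e1.and e2).and (t1.eventually_lt t2.neg hwn)).and self_mem_nhdsWithin).exists
    exact (h.side_of_cone ht hu hc.le hch' h2 h1 hw hwx).2 h3

/-! ### Continuity in time -/

theorem eventually_disjoint (h : IsEvolution S s β E α U p N) {t : ℝ} (ht : t ∈ Icc 0 S)
    {C : Set Space} (hC : IsCompact C) (hd : ∀ x ∈ C, x ∉ p t '' closure U) :
    ∀ᶠ τ in 𝓝[Icc 0 S] t, ∀ x ∈ C, x ∉ p τ '' closure U := by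
  have := (hC.prod h.isCompact_closure).eventually_forall_of_forall_eventually (x₀ := t)
    (P := fun τ z => τ ∈ Icc 0 S → z.2 ∈ closure U → p τ z.2 ≠ z.1) ?_
  · rw [eventually_nhdsWithin_iff]
    filter_upwards [this] with τ hτ hτS x hx
    rintro ⟨u, hu, rfl⟩
    exact hτ (p τ u, u) ⟨hx, hu⟩ hτS hu rfl
  · rintro ⟨x, u⟩ ⟨hx, hu⟩
    have h1 : ContinuousWithinAt (fun z : ℝ × Space × Plane => p z.1 z.2.2 - z.2.1)
        {z | z.1 ∈ Icc 0 S ∧ z.2.2 ∈ closure U} (t, x, u) := by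
      refine ContinuousWithinAt.sub ?_ (by fun_prop)
      have h2 : ContinuousWithinAt (fun z : ℝ × Plane => p z.1 z.2) (Icc 0 S ×ˢ closure U) (t, u) :=
        h.parabolic.continuousOn (t, u) ⟨ht, hu⟩
      refine ContinuousWithinAt.comp (f := fun z : ℝ × Space × Plane => (z.1, z.2.2))
        (x := (t, x, u)) h2 (by fun_prop) ?_
      exact fun z hz => hz
    have h3 := h1.tendsto.eventually ((isOpen_ne (x := (0 : Space))).mem_nhds
      fun h0 => hd x hx ⟨u, hu, sub_eq_zero.1 h0⟩)
    rw [eventually_nhdsWithin_iff] at h3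
    filter_upwards [h3] with z hz h4 h5
    exact sub_ne_zero.1 (hz ⟨h4, h5⟩)

theorem iff_of_connected (h : IsEvolution S s β E α U p N) {t : ℝ} (ht : t ∈ Icc 0 S)
    {C : Set Space} (hC : IsPreconnected C) (hCΩ : C ⊆ halfSpace)
    (hd : ∀ x ∈ C, x ∉ p t '' closure U) {x y : Space} (hx : x ∈ C) (hy : y ∈ C) :
    x ∈ E t ↔ y ∈ E t := by
  rcases h.subset_or_disjoint ht hC hCΩ hd with h1 | h1
  · exact iff_of_true (h1 hx) (h1 hy)
  · exact iff_of_false (Set.disjoint_left.1 h1 hx) (Set.disjoint_left.1 h1 hy)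

end IsEvolution

/-- At all times `τ` close to `t`, either both points or none of them have changed sides. -/
def SideRel (S : ℝ) (E : ℝ → Set Space) (t : ℝ) (x y : Space) : Prop :=
  ∀ᶠ τ in 𝓝[Icc 0 S] t, ((x ∈ E τ ↔ x ∈ E t) ↔ (y ∈ E τ ↔ y ∈ E t))

theorem SideRel.symm {t : ℝ} {x y : Space} (h : SideRel S E t x y) : SideRel S E t y x := by
  filter_upwards [h] with τ hτ using hτ.symm

theorem SideRel.trans {t : ℝ} {x y z : Space} (h : SideRel S E t x y) (h' : SideRel S E t y z) :
    SideRel S E t x z := by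
  filter_upwards [h, h'] with τ h1 h2 using h1.trans h2

namespace IsEvolution

theorem sideRel_of_connected (h : IsEvolution S s β E α U p N) {t : ℝ} (ht : t ∈ Icc 0 S)
    {C : Set Space} (hCc : IsCompact C) (hC : IsPreconnected C) (hCΩ : C ⊆ halfSpace)
    (hd : ∀ x ∈ C, x ∉ p t '' closure U) {x y : Space} (hx : x ∈ C) (hy : y ∈ C) :
    SideRel S E t x y := by
  filter_upwards [h.eventually_disjoint ht hCc hd, self_mem_nhdsWithin] with τ h1 hτ
  rw [h.iff_of_connected ht hC hCΩ hd hx hy, h.iff_of_connected hτ hC hCΩ h1 hx hy]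

/-- For `τ` near `t`, the normal `N τ v` is close to `N t v` or to its opposite. In either case the
two points lie in opposite nappes of a cone with apex `p τ v`, hence on opposite sides of the
surface at time `τ`. The sign itself need not be known. -/
theorem eventually_crossing (h : IsEvolution S s β E α U p N) {t : ℝ} (ht : t ∈ Icc 0 S)
    {v : Plane} (hv : v ∈ U) :
    ∃ ρ : ℝ, 0 < ρ ∧ ∀ ε : ℝ, 0 < ε → ε < ρ → ∀ᶠ τ in 𝓝[Icc 0 S] t,
      (p t v + ε • N t v ∈ E τ ↔ p t v - ε • N t v ∉ E τ) := by
  have hv' := subset_closure hv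
  obtain ⟨ρ₁, hρ₁, hch⟩ := h.exists_chord_bound ht hv' (c := 1 / 2) (by norm_num)
  obtain ⟨ρ₂, hρ₂, hball⟩ := Metric.isOpen_iff.1 isOpen_halfSpace _ (h.mem_halfSpace ht hv)
  have hN1 := (h.normal t ht).norm_eq_one v hv'
  have hNN : inner ℝ (N t v) (N t v) = 1 := by
    rw [real_inner_self_eq_norm_sq, hN1]; norm_num
  refine ⟨min ρ₁ ρ₂, lt_min hρ₁ hρ₂, fun ε hε hερ => ?_⟩
  have hε1 := hερ.trans_le (min_le_left _ _)
  have hε2 := hερ.trans_le (min_le_right _ _)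
  have hp : Tendsto (fun τ => p τ v) (𝓝[Icc 0 S] t) (𝓝 (p t v)) := h.continuousOn_time hv' t ht
  have hD : Tendsto (fun τ => fderivWithin ℝ (p τ) (closure U) v) (𝓝[Icc 0 S] t)
      (𝓝 (fderivWithin ℝ (p t) (closure U) v)) := by
    have h1 := h.parabolic.continuousOn_fderiv (t, v) ⟨ht, hv'⟩
    exact ContinuousWithinAt.comp (f := fun τ : ℝ => (τ, v)) (x := t) h1
      (by fun_prop) (fun τ hτ => ⟨hτ, hv'⟩)
  have eN := hD.eventually (eventually_normal_near _ ((h.param t ht).immersion v hv') hN1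
    ((h.normal t ht).orthogonal v hv') (ε := 1 / 2) (by norm_num))
  have eρ : ∀ᶠ τ in 𝓝[Icc 0 S] t, |τ - t| < ρ₁ :=
    nhdsWithin_le_nhds (Metric.ball_mem_nhds t hρ₁)
  have ed : ∀ᶠ τ in 𝓝[Icc 0 S] t, dist (p τ v) (p t v) < ρ₁ :=
    hp.eventually (Metric.ball_mem_nhds _ hρ₁)
  have cone : ∀ σ : ℝ, |σ| = 1 → ∀ᶠ τ in 𝓝[Icc 0 S] t,
      1 / 2 * ‖p t v + (σ * ε) • N t v - p τ v‖ <
        σ * inner ℝ (p t v + (σ * ε) • N t v - p τ v) (N t v) := by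
    intro σ hσ
    have t1 : Tendsto (fun τ => p t v + (σ * ε) • N t v - p τ v) (𝓝[Icc 0 S] t)
        (𝓝 ((σ * ε) • N t v)) := by
      simpa using (tendsto_const_nhds (x := p t v + (σ * ε) • N t v)).sub hp
    refine (t1.norm.const_mul (1 / 2)).eventually_lt
      ((t1.inner tendsto_const_nhds).const_mul σ) ?_
    rw [norm_smul, real_inner_smul_left, hNN, hN1, Real.norm_eq_abs, abs_mul, hσ, abs_of_pos hε]
    have : σ * σ = 1 := by rw [← abs_mul_abs_self, hσ, one_mul]
    nlinarith
  have hwd : ∀ σ : ℝ, |σ| = 1 → dist (p t v + (σ * ε) • N t v) (p t v) = ε := by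
    intro σ hσ
    rw [dist_eq_norm, add_sub_cancel_left, norm_smul, hN1, Real.norm_eq_abs, abs_mul, hσ,
      abs_of_pos hε]; ring
  filter_upwards [eN, eρ, ed, cone 1 (by simp), cone (-1) (by simp), self_mem_nhdsWithin]
    with τ h1 h2 h3 h4 h5 hτ
  have hch' := hch τ hτ h2
  have d1 := hwd 1 (by simp)
  have d2 := hwd (-1) (by simp)
  simp only [one_mul, neg_mul, neg_smul, ← sub_eq_add_neg] at h4 h5 d1 d2
  have Ω1 : p t v + ε • N t v ∈ halfSpace := hball (by rw [Metric.mem_ball, d1]; exact hε2)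
  have Ω2 : p t v - ε • N t v ∈ halfSpace := hball (by rw [Metric.mem_ball, d2]; exact hε2)
  have hNτ := (h.normal τ hτ).norm_eq_one v hv'
  rcases h1 (N τ v) hNτ ((h.normal τ hτ).orthogonal v hv') with h6 | h6
  · have h7 : 1 / 2 < inner ℝ (N τ v) (N t v) := by
      rw [Metric.mem_ball, dist_eq_norm] at h6
      have := (abs_le.1 (abs_real_inner_le_norm (N τ v - N t v) (N t v))).1
      rw [inner_sub_left, hNN, hN1] at this
      linarith
    exact iff_of_false
      ((h.side_of_cone hτ hv (by norm_num) hch' h3 h7 Ω1 (by rw [d1]; exact hε1)).1 h4)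
      (not_not.2 ((h.side_of_cone hτ hv (by norm_num) hch' h3 h7 Ω2 (by rw [d2]; exact hε1)).2 h5))
  · have h7 : 1 / 2 < inner ℝ (N τ v) (-N t v) := by
      rw [Metric.mem_ball, dist_eq_norm, sub_neg_eq_add] at h6
      have := (abs_le.1 (abs_real_inner_le_norm (N τ v + N t v) (N t v))).2
      rw [inner_add_left, hNN, hN1] at this
      rw [inner_neg_right]
      linarith
    have hch'' : ∀ x ∈ p τ '' closure U, ∀ y ∈ p τ '' closure U, dist x (p t v) < ρ₁ →
        dist y (p t v) < ρ₁ → |inner ℝ (x - y) (-N t v)| ≤ 1 / 2 * ‖x - y‖ := by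
      simpa only [inner_neg_right, abs_neg] using hch'
    exact iff_of_true
      ((h.side_of_cone hτ hv (by norm_num) hch'' h3 h7 Ω1 (by rw [d1]; exact hε1)).2
        (by rwa [inner_neg_right, neg_neg]))
      ((h.side_of_cone hτ hv (by norm_num) hch'' h3 h7 Ω2 (by rw [d2]; exact hε1)).1
        (by rwa [inner_neg_right]))

end IsEvolution

namespace IsEvolution

/-- Points on the normal line close to an interior point are off the surface. -/
theorem exists_normal_segment (h : IsEvolution S s β E α U p N) {t : ℝ} (ht : t ∈ Icc 0 S)
    {v : Plane} (hv : v ∈ U) :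
    ∃ ρ : ℝ, 0 < ρ ∧ Metric.ball (p t v) ρ ⊆ halfSpace ∧
      ∀ x ∈ p t '' closure U, ∀ y ∈ p t '' closure U, dist x (p t v) < ρ → dist y (p t v) < ρ →
        |inner ℝ (x - y) (N t v)| ≤ 1 / 2 * ‖x - y‖ := by
  obtain ⟨ρ₁, hρ₁, hch⟩ := h.exists_chord_bound ht (subset_closure hv) (c := 1 / 2) (by norm_num)
  obtain ⟨ρ₂, hρ₂, hball⟩ := Metric.isOpen_iff.1 isOpen_halfSpace _ (h.mem_halfSpace ht hv)
  refine ⟨min ρ₁ ρ₂, lt_min hρ₁ hρ₂,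
    (Metric.ball_subset_ball (min_le_right _ _)).trans hball, fun x hx y hy h1 h2 => ?_⟩
  exact hch t ht (by simpa using hρ₁) x hx y hy (h1.trans_le (min_le_left _ _))
    (h2.trans_le (min_le_left _ _))

/-- The surface has no interior: near one of its points, a chord along the normal would violate the
chord bound. -/
theorem mem_closure_compl (h : IsEvolution S s β E α U p N) {t : ℝ} (ht : t ∈ Icc 0 S)
    {x : Space} (hx : x ∈ halfSpace) : x ∈ closure (p t '' closure U)ᶜ := by
  by_cases hK : x ∈ p t '' closure U
  swap
  · exact subset_closure hK
  have : x ∈ innerBoundary (E t) := h.halfSpace_inter_image ht ▸ ⟨hx, hK⟩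
  rw [← (h.param t ht).image_interior] at this
  obtain ⟨v, hv, rfl⟩ := this
  obtain ⟨ρ, hρ, -, hch⟩ := h.exists_normal_segment ht hv
  have hN1 := (h.normal t ht).norm_eq_one v (subset_closure hv)
  have hcont : Tendsto (fun ε : ℝ => p t v + ε • N t v) (𝓝[>] 0) (𝓝 (p t v)) := by
    have : Continuous fun ε : ℝ => p t v + ε • N t v := by fun_prop
    simpa using (this.tendsto 0).mono_left nhdsWithin_le_nhds
  refine mem_closure_of_tendsto hcont ?_
  filter_upwards [self_mem_nhdsWithin, hcont.eventually (Metric.ball_mem_nhds _ hρ)]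
    with ε (hε : 0 < ε) h1 h2
  have := hch _ h2 _ hK h1 (by simpa using hρ)
  rw [add_sub_cancel_left, real_inner_smul_left, real_inner_self_eq_norm_sq, norm_smul, hN1,
    Real.norm_of_nonneg hε.le, abs_of_nonneg (by positivity)] at this
  linarith

/-- Near a surface point, every point off the surface can be moved along `N t v` or `-N t v` to one
of the two reference points `p t v ± ε • N t v` without meeting the surface. The reference points
are on opposite sides at time `t` and at nearby times, so they change sides together. -/
theorem eventually_sideRel (h : IsEvolution S s β E α U p N) {t : ℝ} (ht : t ∈ Icc 0 S)
    {z : Space} (hz : z ∈ halfSpace) :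
    ∃ B ∈ 𝓝 z, ∀ x ∈ B, ∀ y ∈ B, x ∉ p t '' closure U → y ∉ p t '' closure U →
      SideRel S E t x y := by
  by_cases hK : z ∈ p t '' closure U
  swap
  · have ho : IsOpen (halfSpace ∩ (p t '' closure U)ᶜ) :=
      isOpen_halfSpace.inter (h.isCompact_image ht).isClosed.isOpen_compl
    obtain ⟨r, hr, hsub⟩ := Metric.nhds_basis_closedBall.mem_iff.1 (ho.mem_nhds ⟨hz, hK⟩)
    refine ⟨Metric.closedBall z r, Metric.closedBall_mem_nhds z hr, fun x hx y hy _ _ => ?_⟩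
    exact h.sideRel_of_connected ht (isCompact_closedBall z r)
      (convex_closedBall z r).isPreconnected (fun w hw => (hsub hw).1) (fun w hw => (hsub hw).2)
      hx hy
  have : z ∈ innerBoundary (E t) := h.halfSpace_inter_image ht ▸ ⟨hz, hK⟩
  rw [← (h.param t ht).image_interior] at this
  obtain ⟨v, hv, rfl⟩ := this
  obtain ⟨ρ₁, hρ₁, hball, hch⟩ := h.exists_normal_segment ht hv
  obtain ⟨ρ₂, hρ₂, hcross⟩ := h.eventually_crossing ht hv
  have hN1 := (h.normal t ht).norm_eq_one v (subset_closure hv)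
  -- Points within `ε / 4` of `p t v`, shifted by at most `ε`, stay in the ball where the chord
  -- bound holds.
  obtain ⟨ε, hε, hε1, hε2⟩ : ∃ ε : ℝ, 0 < ε ∧ 2 * ε < ρ₁ ∧ ε < ρ₂ :=
    ⟨min ρ₁ ρ₂ / 3, by positivity, by linarith [min_le_left ρ₁ ρ₂, lt_min hρ₁ hρ₂],
      by linarith [min_le_right ρ₁ ρ₂, lt_min hρ₁ hρ₂]⟩
  have hrel : SideRel S E t (p t v + ε • N t v) (p t v - ε • N t v) := by
    have hev := hcross ε hε hε2
    have h0 := hev.self_of_nhdsWithin ht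
    filter_upwards [hev] with τ hτ
    rw [hτ, h0]; tauto
  have hNN : inner ℝ (N t v) (N t v) = 1 := by
    rw [real_inner_self_eq_norm_sq, hN1]; norm_num
  have hmove : ∀ n : Space, (n = N t v ∨ n = -N t v) → ∀ y, dist y (p t v) < ε / 4 →
      (∀ r ∈ Icc 0 ε, y + r • n ∉ p t '' closure U) → SideRel S E t y (p t v + ε • n) := by
    intro n hn y hy hfree
    have hn1 : ‖n‖ = 1 := by rcases hn with rfl | rfl <;> simp [hN1]
    have hnn : inner ℝ n n = 1 := by rw [real_inner_self_eq_norm_sq, hn1]; norm_num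
    have hchn : ∀ x ∈ p t '' closure U, dist x (p t v) < ρ₁ →
        inner ℝ (x - p t v) n ≤ 1 / 2 * ‖x - p t v‖ := by
      intro x hx hd
      refine le_trans (le_abs_self _) ?_
      rcases hn with rfl | rfl
      · exact hch x hx _ hK hd (by simpa using hρ₁)
      · rw [inner_neg_right, abs_neg]; exact hch x hx _ hK hd (by simpa using hρ₁)
    have hdist : ∀ r ∈ Icc (0 : ℝ) ε, dist (y + r • n) (p t v) < ρ₁ := by
      intro r hr
      have : dist (y + r • n) y ≤ ε := by
        rw [dist_eq_norm, add_sub_cancel_left, norm_smul, hn1, Real.norm_of_nonneg hr.1, mul_one]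
        exact hr.2
      linarith [dist_triangle (y + r • n) y (p t v)]
    have r1 : SideRel S E t y (y + ε • n) := by
      refine h.sideRel_of_connected ht (C := (fun r : ℝ => y + r • n) '' Icc 0 ε)
        (isCompact_Icc.image (by fun_prop)) (isPreconnected_Icc.image _ (by fun_prop)) ?_ ?_
        ⟨0, ⟨le_rfl, hε.le⟩, by simp⟩ ⟨ε, ⟨hε.le, le_rfl⟩, rfl⟩
      · rintro _ ⟨r, hr, rfl⟩
        exact hball (hdist r hr)
      · rintro _ ⟨r, hr, rfl⟩
        exact hfree r hr
    have hcl : ∀ w ∈ Metric.closedBall (p t v + ε • n) (ε / 4), dist w (p t v) < ρ₁ := by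
      intro w hw
      rw [Metric.mem_closedBall] at hw
      have : dist (p t v + ε • n) (p t v) = ε := by
        rw [dist_eq_norm, add_sub_cancel_left, norm_smul, hn1, Real.norm_of_nonneg hε.le, mul_one]
      linarith [dist_triangle w (p t v + ε • n) (p t v)]
    refine r1.trans ?_
    refine h.sideRel_of_connected ht (isCompact_closedBall (p t v + ε • n) (ε / 4))
      (convex_closedBall _ _).isPreconnected (fun w hw => hball (hcl w hw)) ?_ ?_
      (Metric.mem_closedBall_self (by positivity))
    -- In this ball the component of `w - p t v` along `n` is at least `3 ε / 4`, while half of its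
    -- length is at most `5 ε / 8`, against the chord bound.
    · intro w hw hwK
      have h1 := hchn w hwK (hcl w hw)
      rw [Metric.mem_closedBall, dist_eq_norm] at hw
      set e := w - (p t v + ε • n) with he
      have h2 : w - p t v = e + ε • n := by rw [he]; abel
      have h3 : ‖e + ε • n‖ ≤ ‖e‖ + ε := by
        refine (norm_add_le _ _).trans ?_
        rw [norm_smul, hn1, Real.norm_of_nonneg hε.le, mul_one]
      have h4 := (abs_le.1 (abs_real_inner_le_norm e n)).1
      rw [hn1, mul_one] at h4
      rw [h2, inner_add_left, real_inner_smul_left, hnn] at h1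
      linarith
    · rw [Metric.mem_closedBall, dist_add_right]; exact hy.le
  have hone : ∀ y ∈ Metric.ball (p t v) (ε / 4), y ∉ p t '' closure U →
      SideRel S E t y (p t v + ε • N t v) := by
    intro y hy hyK
    -- If both directions were blocked, two surface points would differ by a nonzero multiple of `N
    -- t v`, against the chord bound. So one direction is free.
    by_cases hfree : ∀ r ∈ Icc 0 ε, y + r • N t v ∉ p t '' closure U
    · exact hmove _ (Or.inl rfl) y hy hfree
    · push Not at hfree
      obtain ⟨r, hr, hrK⟩ := hfree
      have : SideRel S E t y (p t v + ε • -N t v) := by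
        refine hmove _ (Or.inr rfl) y hy fun r' hr' hr'K => ?_
        have hd : ∀ a : ℝ, |a| ≤ ε → dist (y + a • N t v) (p t v) < ρ₁ := by
          intro a ha
          have : dist (y + a • N t v) y ≤ ε := by
            rwa [dist_eq_norm, add_sub_cancel_left, norm_smul, hN1, Real.norm_eq_abs, mul_one]
          have hy : dist y (p t v) < ε / 4 := hy
          linarith [dist_triangle (y + a • N t v) y (p t v)]
        have h0 : 0 < r := by
          refine lt_of_le_of_ne hr.1 fun h0 => hyK ?_
          rwa [← h0, zero_smul, add_zero] at hrK
        rw [smul_neg, ← neg_smul] at hr'K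
        have := hch _ hrK _ hr'K (hd r (by rw [abs_of_nonneg hr.1]; exact hr.2))
          (hd (-r') (by rw [abs_neg, abs_of_nonneg hr'.1]; exact hr'.2))
        have hpos : 0 < r - -r' := by linarith [hr'.1]
        rw [add_sub_add_left_eq_sub, ← sub_smul, real_inner_smul_left, hNN, norm_smul, hN1,
          Real.norm_of_nonneg hpos.le, abs_of_nonneg (by linarith)] at this
        linarith
      rw [smul_neg, ← sub_eq_add_neg] at this
      exact this.trans hrel.symm
  exact ⟨Metric.ball (p t v) (ε / 4), Metric.ball_mem_nhds _ (by positivity),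
    fun x hx y hy hxK hyK => (hone x hx hxK).trans (hone y hy hyK).symm⟩

/-- A point of the half-space which stays outside during the whole evolution. -/
theorem exists_far (h : IsEvolution S s β E α U p N) :
    ∃ x ∈ halfSpace, ∀ t ∈ Icc 0 S, x ∉ E t ∧ x ∉ p t '' closure U := by
  have hcomp : IsCompact ((fun z : ℝ × Plane => p z.1 z.2) '' (Icc 0 S ×ˢ closure U)) :=
    (isCompact_Icc.prod h.isCompact_closure).image_of_continuousOn h.parabolic.continuousOn
  obtain ⟨R, hR⟩ := hcomp.isBounded.exists_norm_le
  set R' := max R 0 + 1 with hR'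
  have hR'0 : 0 < R' := by positivity
  have hmem : ∀ a ∈ Ici R', a • e3 ∈ halfSpace := by
    intro a ha
    have : 0 < a := hR'0.trans_le ha
    simpa [halfSpace, e3] using this
  have hfree : ∀ t ∈ Icc 0 S, ∀ a ∈ Ici R', a • e3 ∉ p t '' closure U := by
    rintro t ht a ha ⟨u, hu, hua⟩
    have h1 := hR _ ⟨(t, u), ⟨ht, hu⟩, rfl⟩
    have ha' : R' ≤ a := ha
    simp only [hua, norm_smul, norm_e3, mul_one] at h1
    have := le_abs_self a
    rw [Real.norm_eq_abs] at h1
    linarith [le_max_left R 0]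
  refine ⟨R' • e3, hmem R' self_mem_Ici, fun t ht => ⟨?_, hfree t ht R' self_mem_Ici⟩⟩
  -- The vertical ray above height `R'` avoids all the surfaces and is unbounded, so it cannot lie
  -- in the bounded set `E t`.
  rcases h.subset_or_disjoint ht (C := (fun a : ℝ => a • e3) '' Ici R')
    (isPreconnected_Ici.image _ (by fun_prop)) (by rintro _ ⟨a, ha, rfl⟩; exact hmem a ha)
    (by rintro _ ⟨a, ha, rfl⟩; exact hfree t ht a ha) with h1 | h1
  · exfalso
    obtain ⟨C, hC⟩ := (h.droplet t ht).bounded.exists_norm_le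
    have := hC _ (h1 ⟨max R' (C + 1), mem_Ici.2 (le_max_left _ _), rfl⟩)
    rw [norm_smul, norm_e3, mul_one, Real.norm_eq_abs] at this
    linarith [le_abs_self (max R' (C + 1)), le_max_right R' (C + 1)]
  · exact Set.disjoint_left.1 h1 ⟨R', self_mem_Ici, rfl⟩

/-- Off the surface, membership in `E τ` is constant for `τ` close to `t`. -/
theorem eventually_mem_iff (h : IsEvolution S s β E α U p N) {t : ℝ} (ht : t ∈ Icc 0 S)
    {x : Space} (hx : x ∈ halfSpace) (hxK : x ∉ p t '' closure U) :
    ∀ᶠ τ in 𝓝[Icc 0 S] t, (x ∈ E τ ↔ x ∈ E t) := by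
  obtain ⟨y, hy, hyfar⟩ := h.exists_far
  -- `G` collects the points around which everything off the surface changes sides together with
  -- `y`. It is open by construction and relatively closed by `eventually_sideRel`, because
  -- off-surface points are dense. Connectedness of the half-space gives all of it, and `y` never
  -- changes side.
  set G : Set Space := {z | ∀ᶠ w in 𝓝 z, w ∉ p t '' closure U → SideRel S E t w y} with hG
  have hGo : IsOpen G := by
    rw [isOpen_iff_mem_nhds]
    intro z hz
    exact eventually_eventually_nhds.2 hz
  have hsub : halfSpace ⊆ G := by
    refine convex_halfSpace.isPreconnected.subset_of_closure_inter_subset hGo ⟨y, hy, ?_⟩ ?_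
    · obtain ⟨B, hB, hrel⟩ := h.eventually_sideRel ht hy
      filter_upwards [hB] with w hw hwK
      exact hrel w hw y (mem_of_mem_nhds hB) hwK (hyfar t ht).2
    · rintro z ⟨hzG, hz⟩
      obtain ⟨B, hB, hrel⟩ := h.eventually_sideRel ht hz
      obtain ⟨B', hB', hB'o, hzB'⟩ := mem_nhds_iff.1 hB
      obtain ⟨w, ⟨hw1, hw2⟩, hwG⟩ :=
        mem_closure_iff.1 hzG _ (hB'o.inter isOpen_halfSpace) ⟨hzB', hz⟩
      have hwG' : ∀ᶠ v in 𝓝 w, (v ∉ p t '' closure U → SideRel S E t v y) ∧ v ∈ B' :=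
        hwG.and (hB'o.mem_nhds hw1)
      obtain ⟨v, hvK, hv1, hv2⟩ :=
        ((mem_closure_iff_frequently.1 (h.mem_closure_compl ht hw2)).and_eventually hwG').exists
      filter_upwards [hB] with w' hw' hw'K
      exact (hrel w' hw' v (hB' hv2) hw'K hvK).trans (hv1 hvK)
  have hxy : SideRel S E t x y := (hsub hx).self_of_nhds hxK
  filter_upwards [hxy, self_mem_nhdsWithin] with τ hτ hτS
  exact hτ.2 (iff_of_false (hyfar τ hτS).1 (hyfar t ht).1)

/-- A closed ball around `x` stays off the surface for all nearby times, so at each such time it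
lies on one side and only its centre has to be followed. -/
theorem eventually_mem_iff_prod (h : IsEvolution S s β E α U p N) {t : ℝ} (ht : t ∈ Icc 0 S)
    {x : Space} (hx : x ∈ halfSpace) (hxK : x ∉ p t '' closure U) :
    ∀ᶠ z in 𝓝[Icc 0 S] t ×ˢ 𝓝 x, (z.2 ∈ E z.1 ↔ x ∈ E t) := by
  have ho : IsOpen (halfSpace ∩ (p t '' closure U)ᶜ) :=
    isOpen_halfSpace.inter (h.isCompact_image ht).isClosed.isOpen_compl
  obtain ⟨r, hr, hsub⟩ := Metric.nhds_basis_closedBall.mem_iff.1 (ho.mem_nhds ⟨hx, hxK⟩)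
  have h1 := h.eventually_disjoint ht (isCompact_closedBall x r) fun w hw => (hsub hw).2
  have h2 := h.eventually_mem_iff ht hx hxK
  have h3 : ∀ᶠ τ in 𝓝[Icc 0 S] t, τ ∈ Icc 0 S := self_mem_nhdsWithin
  filter_upwards [((h1.and h2).and h3).prod_mk (Metric.closedBall_mem_nhds x hr)]
    with z ⟨⟨⟨h4, h5⟩, h6⟩, h7⟩
  rw [← h5]
  exact h.iff_of_connected h6 (convex_closedBall x r).isPreconnected (fun w hw => (hsub hw).1) h4
    h7 (Metric.mem_closedBall_self hr.le)

/-- A curve which avoids the moving surface stays on one side. -/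
theorem mem_iff_of_curve (h : IsEvolution S s β E α U p N) {r : ℝ} (hr : r ∈ Icc 0 S)
    {γ : ℝ → Space} (hγ : ContinuousOn γ (Icc 0 r)) (hγΩ : ∀ t ∈ Icc 0 r, γ t ∈ halfSpace)
    (hγK : ∀ t ∈ Icc 0 r, γ t ∉ p t '' closure U) : γ r ∈ E r ↔ γ 0 ∈ E 0 := by
  classical
  have hcont : ContinuousOn (fun t => decide (γ t ∈ E t)) (Icc 0 r) := by
    intro t ht
    have hsub : Icc 0 r ⊆ Icc 0 S := Icc_subset_Icc_right hr.2
    have h1 := h.eventually_mem_iff_prod (hsub ht) (hγΩ t ht) (hγK t ht)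
    have h2 : Tendsto (fun τ => (τ, γ τ)) (𝓝[Icc 0 r] t) (𝓝[Icc 0 S] t ×ˢ 𝓝 (γ t)) :=
      (tendsto_id.mono_left (nhdsWithin_mono t hsub)).prodMk (hγ t ht)
    refine tendsto_const_nhds.congr' ?_
    filter_upwards [h2.eventually h1] with τ hτ
    exact (decide_eq_decide.2 hτ).symm
  have := isPreconnected_Icc.constant hcont (right_mem_Icc.2 hr.1) (left_mem_Icc.2 hr.1)
  exact decide_eq_decide.1 this

end IsEvolution

/-- If a point of `A` were outside `B`, then `interior A ∩ (closure B)ᶜ` would meet the half-space.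
By the boundary hypotheses it is relatively closed there, hence would contain the whole connected
half-space, including the point outside `A`. -/
theorem subset_of_frontiers {A B : Set Space} (hA : A ⊆ halfSpace)
    (hfar : ∃ x ∈ halfSpace, x ∉ A) (h1 : innerBoundary A ⊆ B)
    (h2 : ∀ x ∈ innerBoundary B, x ∉ A) (hd : Disjoint (innerBoundary A) (innerBoundary B)) :
    A ⊆ B := by
  intro y hyA
  by_contra hyB
  obtain ⟨x, hx, hxA⟩ := hfar
  have hy := hA hyA
  have mem_or : ∀ {D : Set Space} {z : Space}, z ∈ halfSpace → z ∈ closure D →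
      z ∈ interior D ∨ z ∈ innerBoundary D := by
    intro D z hz hzD
    by_cases h : z ∈ interior D
    · exact Or.inl h
    · exact Or.inr ⟨hz, hzD, h⟩
  have key : halfSpace ⊆ interior A ∩ (closure B)ᶜ := by
    refine convex_halfSpace.isPreconnected.subset_of_closure_inter_subset
      (isOpen_interior.inter isClosed_closure.isOpen_compl) ⟨y, hy, ?_, ?_⟩ ?_
    · exact (mem_or hy (subset_closure hyA)).resolve_right fun h => hyB (h1 h)
    · intro hcl
      rcases mem_or hy hcl with h | h
      · exact hyB (interior_subset h)
      · exact h2 y h hyA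
    · rintro z ⟨hzW, hz⟩
      have hzA : z ∈ closure A :=
        closure_mono (inter_subset_left.trans interior_subset) hzW
      have hzB : z ∉ interior B := by
        intro hzB
        obtain ⟨w, hw1, hw2⟩ := mem_closure_iff.1 hzW _ isOpen_interior hzB
        exact hw2.2 (subset_closure (interior_subset hw1))
      have hzA' : z ∈ interior A := by
        refine (mem_or hz hzA).resolve_right fun h => ?_
        rcases mem_or hz (subset_closure (h1 h)) with h' | h'
        · exact hzB h'
        · exact Set.disjoint_left.1 hd h h'
      refine ⟨hzA', fun hcl => ?_⟩
      rcases mem_or hz hcl with h | h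
      · exact hzB h
      · exact h2 z h (interior_subset hzA')
  exact hxA (interior_subset (key hx).1)

/-- As long as the closed surfaces are disjoint, the inclusion is preserved. -/
theorem inclusion_of_disjoint {s₁ s₂ : ℝ} {β₁ β₂ : Plane → ℝ} {E₁ E₂ : ℝ → Set Space}
    {α₁ α₂ : ℝ≥0} {U₁ U₂ : Set Plane} {p₁ p₂ N₁ N₂ : ℝ → Plane → Space}
    (h₁ : IsEvolution S s₁ β₁ E₁ α₁ U₁ p₁ N₁) (h₂ : IsEvolution S s₂ β₂ E₂ α₂ U₂ p₂ N₂)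
    {r : ℝ} (hr : r ∈ Icc 0 S) (h0 : E₁ 0 ⊆ E₂ 0)
    (hd : ∀ t ∈ Icc 0 r, Disjoint (p₁ t '' closure U₁) (p₂ t '' closure U₂)) :
    E₁ r ⊆ E₂ r := by
  have hsub : Icc 0 r ⊆ Icc 0 S := Icc_subset_Icc_right hr.2
  have hr0 : r ∈ Icc 0 r := right_mem_Icc.2 hr.1
  have h00 : (0 : ℝ) ∈ Icc 0 r := left_mem_Icc.2 hr.1
  have n12 : ∀ t ∈ Icc 0 r, ∀ u ∈ U₁, p₁ t u ∉ p₂ t '' closure U₂ := fun t ht u hu =>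
    Set.disjoint_left.1 (hd t ht) ⟨u, subset_closure hu, rfl⟩
  have n21 : ∀ t ∈ Icc 0 r, ∀ u ∈ U₂, p₂ t u ∉ p₁ t '' closure U₁ := fun t ht u hu =>
    Set.disjoint_right.1 (hd t ht) ⟨u, subset_closure hu, rfl⟩
  obtain ⟨x, hx, hxfar⟩ := h₁.exists_far
  refine subset_of_frontiers (h₁.droplet r hr).subset ⟨x, hx, (hxfar r hr).1⟩ ?_ ?_ ?_
  · intro y hy
    rw [← (h₁.param r hr).image_interior] at hy
    obtain ⟨u, hu, rfl⟩ := hy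
    -- The boundary point is followed back along its own trajectory, which never meets the other
    -- surface. At time `0` it must lie in `E₂ 0`, since otherwise it would be a boundary point of
    -- `E₂ 0`.
    refine (h₂.mem_iff_of_curve hr (γ := fun t => p₁ t u)
      ((h₁.continuousOn_time (subset_closure hu)).mono hsub)
      (fun t ht => h₁.mem_halfSpace (hsub ht) hu) (fun t ht => n12 t ht u hu)).2 ?_
    have hb := h₁.mem_innerBoundary (hsub h00) hu
    by_contra hn
    have hb2 : p₁ 0 u ∈ innerBoundary (E₂ 0) :=
      ⟨hb.1, closure_mono h0 hb.2.1, fun hi => hn (interior_subset hi)⟩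
    rw [← h₂.halfSpace_inter_image (hsub h00)] at hb2
    exact n12 0 h00 u hu hb2.2
  · intro y hy
    rw [← (h₂.param r hr).image_interior] at hy
    obtain ⟨u, hu, rfl⟩ := hy
    refine fun hmem => ?_
    have := (h₁.mem_iff_of_curve hr (γ := fun t => p₂ t u)
      ((h₂.continuousOn_time (subset_closure hu)).mono hsub)
      (fun t ht => h₂.mem_halfSpace (hsub ht) hu) (fun t ht => n21 t ht u hu)).1 hmem
    have hb := h₂.mem_innerBoundary (hsub h00) hu
    have hb1 : p₂ 0 u ∈ innerBoundary (E₁ 0) :=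
      ⟨hb.1, subset_closure this, fun hi => hb.2.2 (interior_mono h0 hi)⟩
    rw [← h₁.halfSpace_inter_image (hsub h00)] at hb1
    exact n21 0 h00 u hu hb1.2
  · rw [← h₁.halfSpace_inter_image hr, ← h₂.halfSpace_inter_image hr]
    exact (hd r hr0).mono inter_subset_right inter_subset_right

/-! ### The contact condition -/

theorem continuous_toPlane : Continuous toPlane := by
  unfold toPlane
  fun_prop

namespace IsEvolution

/-- First variation at a nearest point. -/
theorem inner_nonneg_of_nearest (h : IsEvolution S s β E α U p N) {t : ℝ} (ht : t ∈ Icc 0 S)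
    {u : Plane} (hu : u ∈ closure U) {y : Space}
    (hmin : ∀ v ∈ closure U, dist (p t u) y ≤ dist (p t v) y) {w : Plane}
    (hw : w ∈ posTangentConeAt (closure U) u) :
    0 ≤ inner ℝ (fderivWithin ℝ (p t) (closure U) u w) (p t u - y) := by
  have hd := ((h.hasFDerivWithinAt ht hu).sub_const y).norm_sq
  have hm : IsLocalMinOn (fun v => ‖p t v - y‖ ^ 2) (closure U) u := by
    refine Filter.eventually_of_mem self_mem_nhdsWithin fun v hv => ?_
    have := hmin v hv
    rw [dist_eq_norm, dist_eq_norm] at this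
    exact pow_le_pow_left₀ (norm_nonneg _) this 2
  have := hm.hasFDerivWithinAt_nonneg hd hw
  simp at this
  rw [real_inner_comm, inner_sub_left]
  linarith

theorem inner_eq_zero_of_nearest (h : IsEvolution S s β E α U p N) {t : ℝ} (ht : t ∈ Icc 0 S)
    {u : Plane} (hu : u ∈ U) {y : Space}
    (hmin : ∀ v ∈ closure U, dist (p t u) y ≤ dist (p t v) y) (w : Plane) :
    inner ℝ (fderivWithin ℝ (p t) (closure U) u w) (p t u - y) = 0 := by
  have hcone : ∀ w : Plane, w ∈ posTangentConeAt (closure U) u := by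
    intro w
    refine mem_posTangentConeAt_of_frequently_mem (Eventually.frequently ?_)
    have hcont : Tendsto (fun ε : ℝ => u + ε • w) (𝓝[>] 0) (𝓝 u) := by
      have : Continuous fun ε : ℝ => u + ε • w := by fun_prop
      simpa using (this.tendsto 0).mono_left nhdsWithin_le_nhds
    filter_upwards [hcont.eventually (h.domain.isOpen.mem_nhds hu)] with ε hε
      using subset_closure hε
  have h1 := h.inner_nonneg_of_nearest ht (subset_closure hu) hmin (hcone w)
  have h2 := h.inner_nonneg_of_nearest ht (subset_closure hu) hmin (hcone (-w))
  rw [map_neg, inner_neg_left] at h2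
  linarith

theorem inner_e3_nonneg (h : IsEvolution S s β E α U p N) {t : ℝ} (ht : t ∈ Icc 0 S)
    {u : Plane} (hu : u ∈ frontier U) {w : Plane}
    (hw : w ∈ posTangentConeAt (closure U) u) :
    0 ≤ inner ℝ (fderivWithin ℝ (p t) (closure U) u w) e3 := by
  have hd := ((EuclideanSpace.proj 2 : Space →L[ℝ] ℝ).hasFDerivAt).comp_hasFDerivWithinAt u
    (h.hasFDerivWithinAt ht (frontier_subset_closure hu))
  have hm : IsLocalMinOn ((EuclideanSpace.proj 2 : Space →L[ℝ] ℝ) ∘ p t) (closure U) u := by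
    refine Filter.eventually_of_mem self_mem_nhdsWithin fun v hv => ?_
    have h1 := h.height_nonneg ht hv
    have h2 := (h.param t ht).height_zero u hu
    simpa [h2] using h1
  have := hm.hasFDerivWithinAt_nonneg hd hw
  rw [inner_e3]
  simpa using this

/-- Coercivity of the angle makes the surface transversal to `∂Ω`, which excludes a horizontal
tangent plane there. -/
theorem abs_inner_normal_e3_lt (h : IsEvolution S s β E α U p N) {t : ℝ} (ht : t ∈ Icc 0 S)
    {u : Plane} (hu : u ∈ frontier U) : |inner ℝ (N t u) e3| < 1 := by
  obtain ⟨η, hη, -, hb⟩ := h.angle.coercive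
  rw [h.contact t ht u hu, abs_neg]
  linarith [hb (toPlane (p t u))]

/-- At a boundary point where the distance to the other surface is attained in direction `n`, the
slope of `n` is at most the slope of the normal. -/
theorem inner_e3_le_of_frontier (h : IsEvolution S s β E α U p N) {t : ℝ} (ht : t ∈ Icc 0 S)
    {u : Plane} (hu : u ∈ frontier U) {n M : Space} (hn : ‖n‖ = 1)
    (hM : M = N t u ∨ M = -N t u) (hnM : 0 ≤ inner ℝ n M) (hne : 0 ≤ inner ℝ n e3)
    (hvar : ∀ w ∈ posTangentConeAt (closure U) u,
      inner ℝ (fderivWithin ℝ (p t) (closure U) u w) n ≤ 0) :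
    inner ℝ n e3 ≤ inner ℝ M e3 := by
  have huc := frontier_subset_closure hu
  have hN1 := (h.normal t ht).norm_eq_one u huc
  have hAN := (h.normal t ht).orthogonal u huc
  have hinj := (h.param t ht).immersion u huc
  set A := fderivWithin ℝ (p t) (closure U) u with hA
  obtain ⟨g, hg, hin⟩ := h.domain.exists_inward hu
  have hcone : ∀ w, g w < 0 → w ∈ posTangentConeAt (closure U) u := fun w hw =>
    mem_posTangentConeAt_of_frequently_mem
      (((hin w hw).mono fun r hr => subset_closure hr).frequently)
  -- On parameter directions, `n` and `-e₃` both act as nonnegative multiples of the conormal `g`: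
  -- the distance cannot decrease and the height cannot become negative when moving inward. Since `b
  -- ≠ 0` by transversality, `n + (a / b) e₃` annihilates the tangent plane and is a multiple of the
  -- normal.
  obtain ⟨a, ha, hna⟩ := exists_nonneg_smul_of_nonpos (ℓ := (innerSL ℝ n).comp A) hg
    (fun w hw => by simpa [real_inner_comm] using hvar w (hcone w hw))
  obtain ⟨b, hb, heb⟩ := exists_nonneg_smul_of_nonpos (ℓ := -(innerSL ℝ e3).comp A) hg
    (fun w hw => by simpa [real_inner_comm] using h.inner_e3_nonneg ht hu (hcone w hw))
  have hna' : ∀ w, inner ℝ (A w) n = a * g w := fun w => by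
    rw [real_inner_comm]; simpa using hna w
  have heb' : ∀ w, inner ℝ (A w) e3 = -(b * g w) := fun w => by
    rw [real_inner_comm, ← heb w]; simp
  have hb0 : b ≠ 0 := by
    rintro rfl
    have hlt := h.abs_inner_normal_e3_lt ht hu
    rcases eq_or_eq_neg_of_orthogonal A hinj hN1 hAN norm_e3 (fun w => by rw [heb']; ring)
      with h1 | h1
    · rw [h1, real_inner_self_eq_norm_sq, hN1] at hlt; norm_num at hlt
    · rw [h1, inner_neg_right, real_inner_self_eq_norm_sq, hN1] at hlt; norm_num at hlt
  have hM1 : ‖M‖ = 1 := by rcases hM with rfl | rfl <;> simp [hN1]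
  have hAM : ∀ w, inner ℝ (A w) M = 0 := by
    intro w
    rcases hM with rfl | rfl
    · exact hAN w
    · rw [inner_neg_right, hAN, neg_zero]
  have horth : ∀ w, inner ℝ (A w) (n + (a / b) • e3) = 0 := by
    intro w
    rw [inner_add_right, real_inner_smul_right, hna', heb']
    field_simp
    ring
  exact inner_e3_le_of_add_smul_eq hn hM1 (div_nonneg ha hb)
    (eq_inner_smul_of_orthogonal A hinj hM1 hAM horth) hnM hne

theorem continuousOn_contactAngle (h : IsEvolution S s β E α U p N) :
    ContinuousOn (fun z : ℝ × Plane => β (toPlane (p z.1 z.2))) (Icc 0 S ×ˢ closure U) :=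
  (h.angle.contDiff.continuous.comp continuous_toPlane).comp_continuousOn h.parabolic.continuousOn

/-- The normal is not known to be continuous in time, but its tangent plane is. Along a segment in
`closure U` from `u` to a frontier point `y`, the normals at time `τ` stay in two disjoint balls
around `± N t v`, hence in one of them by connectedness. So `N τ u` is close to `N τ y`, where the
contact condition is exact. -/
theorem exists_contact_near_frontier (h : IsEvolution S s β E α U p N) {t : ℝ}
    (ht : t ∈ Icc 0 S) {v : Plane} (hv : v ∈ frontier U) {ε : ℝ} (hε : 0 < ε) :
    ∀ᶠ z : ℝ × Plane in 𝓝[Icc 0 S ×ˢ closure U] (t, v),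
      |inner ℝ (N z.1 z.2) e3 + β (toPlane (p z.1 z.2))| < ε := by
  have hvc := frontier_subset_closure hv
  have hN1 := (h.normal t ht).norm_eq_one v hvc
  -- The bound `1 / 2` separates the two balls; the bound `ε / 4` leaves `ε / 2` for the normals and
  -- `ε / 2` for the variation of `β`.
  set ε' := min (ε / 4) (1 / 2) with hε'
  have hε'0 : 0 < ε' := lt_min (by positivity) (by norm_num)
  have e1 := (h.parabolic.continuousOn_fderiv (t, v) ⟨ht, hvc⟩).tendsto.eventually
    (eventually_normal_near _ ((h.param t ht).immersion v hvc) hN1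
      ((h.normal t ht).orthogonal v hvc) hε'0)
  have e2 := (h.continuousOn_contactAngle (t, v) ⟨ht, hvc⟩).tendsto.eventually
    (Metric.ball_mem_nhds _ (show 0 < ε / 4 by positivity))
  obtain ⟨r, hr, hsub⟩ := Metric.mem_nhdsWithin_iff.1 (e1.and e2)
  rw [Filter.Eventually, Metric.mem_nhdsWithin_iff]
  refine ⟨r / 2, by positivity, ?_⟩
  rintro ⟨τ, u⟩ ⟨hz, hτ, hu⟩
  rw [← ball_prod_same] at hz
  obtain ⟨hz1, hz2⟩ := hz
  change |inner ℝ (N τ u) e3 + β (toPlane (p τ u))| < ε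
  change τ ∈ Icc 0 S at hτ
  change u ∈ closure U at hu
  change dist τ t < r / 2 at hz1
  change dist u v < r / 2 at hz2
  obtain ⟨y, hy, hseg, hdist⟩ := exists_frontier_segment hu hv
  have hgood : ∀ z ∈ segment ℝ u y,
      (∀ M : Space, ‖M‖ = 1 → (∀ w, inner ℝ (fderivWithin ℝ (p τ) (closure U) z w) M = 0) →
        M ∈ Metric.ball (N t v) ε' ∪ Metric.ball (-N t v) ε') ∧
      β (toPlane (p τ z)) ∈ Metric.ball (β (toPlane (p t v))) (ε / 4) := by
    intro z hz
    refine @hsub (τ, z) ⟨?_, hτ, hseg hz⟩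
    rw [← ball_prod_same]
    refine ⟨by rw [Metric.mem_ball]; linarith, ?_⟩
    have : dist z u ≤ dist y u :=
      (convex_closedBall u (dist y u)).segment_subset (Metric.mem_closedBall_self dist_nonneg)
        (Metric.mem_closedBall.2 le_rfl) hz
    rw [dist_comm y u] at this
    change dist z v < r
    linarith [dist_triangle z u v]
  have hpre : IsPreconnected (N τ '' segment ℝ u y) :=
    (convex_segment u y).isPreconnected.image _ ((h.normal τ hτ).continuousOn.mono hseg)
  have hcov : N τ '' segment ℝ u y ⊆ Metric.ball (N t v) ε' ∪ Metric.ball (-N t v) ε' := by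
    rintro _ ⟨z, hz, rfl⟩
    exact (hgood z hz).1 _ ((h.normal τ hτ).norm_eq_one z (hseg hz))
      ((h.normal τ hτ).orthogonal z (hseg hz))
  have hdisj : Disjoint (Metric.ball (N t v) ε') (Metric.ball (-N t v) ε') := by
    refine Metric.ball_disjoint_ball ?_
    have e : N t v + N t v = (2 : ℝ) • N t v := (two_smul ℝ _).symm
    rw [dist_eq_norm, sub_neg_eq_add, e, norm_smul, hN1]
    have : ε' ≤ 1 / 2 := min_le_right _ _
    norm_num
    linarith
  have hclose : dist (N τ u) (N τ y) < ε / 2 := by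
    have hu' : N τ u ∈ N τ '' segment ℝ u y := ⟨u, left_mem_segment ℝ u y, rfl⟩
    have hy' : N τ y ∈ N τ '' segment ℝ u y := ⟨y, right_mem_segment ℝ u y, rfl⟩
    have h4 : ε' ≤ ε / 4 := min_le_left _ _
    rcases hpre.subset_or_subset Metric.isOpen_ball Metric.isOpen_ball hdisj hcov with h1 | h1
    all_goals
      have h2 := h1 hu'
      have h3 := h1 hy'
      rw [Metric.mem_ball] at h2 h3
      linarith [dist_triangle_right (N τ u) (N τ y) (N t v),
        dist_triangle_right (N τ u) (N τ y) (-N t v)]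
  have hb1 := (hgood u (left_mem_segment ℝ u y)).2
  have hb2 := (hgood y (right_mem_segment ℝ u y)).2
  rw [Metric.mem_ball, Real.dist_eq, abs_lt] at hb1 hb2
  have hc := h.contact τ hτ y hy
  have hi := abs_real_inner_le_norm (N τ u - N τ y) e3
  rw [norm_e3, mul_one, inner_sub_left, hc, abs_le] at hi
  rw [dist_eq_norm] at hclose
  rw [abs_lt]
  constructor <;> linarith [hi.1, hi.2, hb1.1, hb1.2, hb2.1, hb2.2]

/-- The contact condition holds approximately near the boundary, uniformly in time. -/
theorem exists_contact_near (h : IsEvolution S s β E α U p N) {ε : ℝ} (hε : 0 < ε) :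
    ∃ δ : ℝ, 0 < δ ∧ ∀ t ∈ Icc 0 S, ∀ u ∈ closure U, p t u 2 ≤ δ →
      |inner ℝ (N t u) e3 + β (toPlane (p t u))| < ε := by
  have hZ : IsCompact (Icc 0 S ×ˢ closure U) := isCompact_Icc.prod h.isCompact_closure
  suffices hs : ∃ δ : ℝ, 0 < δ ∧ ∀ z ∈ Icc 0 S ×ˢ closure U, p z.1 z.2 2 ≤ δ →
      |inner ℝ (N z.1 z.2) e3 + β (toPlane (p z.1 z.2))| < ε by
    obtain ⟨δ, hδ, hs⟩ := hs
    exact ⟨δ, hδ, fun t ht u hu => hs (t, u) ⟨ht, hu⟩⟩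
  refine hZ.induction_on (p := fun A => ∃ δ : ℝ, 0 < δ ∧ ∀ z ∈ A, p z.1 z.2 2 ≤ δ →
      |inner ℝ (N z.1 z.2) e3 + β (toPlane (p z.1 z.2))| < ε) ⟨1, one_pos, by simp⟩ ?_ ?_ ?_
  · rintro A B hAB ⟨δ, hδ, hB⟩
    exact ⟨δ, hδ, fun z hz => hB z (hAB hz)⟩
  · rintro A B ⟨δ, hδ, hA⟩ ⟨δ', hδ', hB⟩
    refine ⟨min δ δ', lt_min hδ hδ', fun z hz hle => ?_⟩
    rcases hz with hz | hz
    · exact hA z hz (hle.trans (min_le_left _ _))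
    · exact hB z hz (hle.trans (min_le_right _ _))
  · rintro ⟨t, v⟩ ⟨ht, hv⟩
    change v ∈ closure U at hv
    rw [closure_eq_union_frontier] at hv
    rcases hv with hv | hv
    -- Around an interior parameter the height is bounded below, so a smaller `δ` makes the claim
    -- vacuous.
    · have hpos := (h.param t ht).height_pos v hv
      have hc : ContinuousWithinAt (fun z : ℝ × Plane => p z.1 z.2 2) (Icc 0 S ×ˢ closure U)
          (t, v) := continuous_height.continuousAt.comp_continuousWithinAt
            (h.parabolic.continuousOn (t, v) ⟨ht, subset_closure hv⟩)
      refine ⟨_, hc.tendsto.eventually (lt_mem_nhds (show p t v 2 / 2 < p t v 2 by linarith)),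
        p t v 2 / 2, by linarith, fun z hz hle => ?_⟩
      exact absurd hz (not_lt.2 hle)
    · exact ⟨_, h.exists_contact_near_frontier ht hv hε, 1, one_pos, fun z hz _ => hz⟩

end IsEvolution

/-! ### Nearest points of two surfaces -/

namespace IsEvolution

/-- If `p t v` is the point of the surface nearest to `y`, the normal at `p t v` tells the side
on which `y` lies. -/
theorem side_of_nearest (h : IsEvolution S s β E α U p N) {t : ℝ} (ht : t ∈ Icc 0 S)
    {v : Plane} (hv : v ∈ closure U) {y : Space} (hy : 0 ≤ y 2) (hne : y ≠ p t v)
    (hmin : ∀ v' ∈ closure U, dist (p t v) y ≤ dist (p t v') y) :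
    (0 < inner ℝ (y - p t v) (N t v) →
      ∃ r : ℝ, 0 < r ∧ ∀ w ∈ halfSpace, dist w y < r → w ∉ E t) ∧
    (0 < -inner ℝ (y - p t v) (N t v) →
      ∃ r : ℝ, 0 < r ∧ ∀ w ∈ halfSpace, dist w y < r → w ∈ E t) := by
  have hN1 := (h.normal t ht).norm_eq_one v hv
  set x := p t v with hx
  have hx2 : 0 ≤ x 2 := h.height_nonneg ht hv
  set d := ‖y - x‖ with hd
  have hd0 : 0 < d := norm_pos_iff.2 (sub_ne_zero.2 hne)
  -- Points of the segment from `x` to `y` other than `x` are closer to `y` than the surface is. A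
  -- thin neighbourhood of the segment from `z` to `y`, cut by the half-space, is therefore on one
  -- side; it reaches from near `y` to a point `w` near `x`, whose side is read off from the cone.
  -- The sign `σ = ± 1` treats both nappes.
  have key : ∀ c ρ : ℝ, 0 < ρ → ∀ σ : ℝ, c * d < σ * inner ℝ (y - x) (N t v) →
      ∃ (T : Set Space) (w : Space), (T ⊆ E t ∨ Disjoint T (E t)) ∧ w ∈ T ∧ w ∈ halfSpace ∧
        dist w x < ρ ∧ c * ‖w - x‖ < σ * inner ℝ (w - x) (N t v) ∧
        ∃ r : ℝ, 0 < r ∧ ∀ w ∈ halfSpace, dist w y < r → w ∈ T := by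
    intro c ρ hρ σ hσ
    obtain ⟨θ, hθ0, hθ1, hθρ⟩ : ∃ θ : ℝ, 0 < θ ∧ θ < 1 ∧ θ * d < ρ := by
      refine ⟨min (1 / 2) (ρ / (2 * d)), by positivity,
        (min_le_left _ _).trans_lt (by norm_num), ?_⟩
      calc min (1 / 2) (ρ / (2 * d)) * d ≤ ρ / (2 * d) * d := by gcongr; exact min_le_right _ _
        _ < ρ := by field_simp; linarith
    set z := x + θ • (y - x) with hz
    have hzy : y - z = (1 - θ) • (y - x) := by rw [hz, sub_smul, one_smul]; abel
    have hz2 : 0 ≤ z 2 := by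
      have : z 2 = (1 - θ) * x 2 + θ * y 2 := by simp [hz]; ring
      rw [this]
      have := sub_pos.2 hθ1
      positivity
    have hfree : Disjoint (segment ℝ z y) (p t '' closure U) := by
      refine Set.disjoint_left.2 ?_
      rintro _ hwz ⟨v', hv', rfl⟩
      have h1 := hmin v' hv'
      have h2 : dist (p t v') y ≤ dist z y :=
        (convex_closedBall y (dist z y)).segment_subset (Metric.mem_closedBall.2 le_rfl)
          (Metric.mem_closedBall_self dist_nonneg) hwz
      rw [dist_comm z y, dist_eq_norm y z, hzy, norm_smul,
        Real.norm_of_nonneg (by linarith : 0 ≤ 1 - θ), ← hd] at h2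
      rw [dist_comm x y, dist_eq_norm y x, ← hd] at h1
      nlinarith
    have hcomp : IsCompact (segment ℝ z y) := by
      rw [segment_eq_image']
      exact isCompact_Icc.image (by fun_prop)
    obtain ⟨r, hr, hdis⟩ := hfree.exists_thickenings hcomp (h.isCompact_image ht).isClosed
    have hT : IsPreconnected (halfSpace ∩ Metric.thickening r (segment ℝ z y)) :=
      (convex_halfSpace.inter ((convex_segment z y).thickening r)).isPreconnected
    -- Both `x` and `y` may lie on `∂Ω`, so `z` is lifted slightly to enter `Ω`.
    have t0 : Tendsto (fun η : ℝ => z + η • e3) (𝓝[>] 0) (𝓝 z) := by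
      have : Continuous fun η : ℝ => z + η • e3 := by fun_prop
      simpa using (this.tendsto 0).mono_left nhdsWithin_le_nhds
    have t1 : Tendsto (fun η : ℝ => z + η • e3 - x) (𝓝[>] 0) (𝓝 (θ • (y - x))) := by
      have := t0.sub_const x
      rwa [hz, add_sub_cancel_left] at this
    have ev1 : ∀ᶠ η : ℝ in 𝓝[>] 0,
        c * ‖z + η • e3 - x‖ < σ * inner ℝ (z + η • e3 - x) (N t v) := by
      refine (t1.norm.const_mul c).eventually_lt
        ((t1.inner tendsto_const_nhds).const_mul σ) ?_
      rw [norm_smul, real_inner_smul_left, Real.norm_of_nonneg hθ0.le, ← hd]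
      nlinarith
    have ev2 : ∀ᶠ η : ℝ in 𝓝[>] 0, dist (z + η • e3) x < ρ := by
      have := t1.norm
      rw [norm_smul, Real.norm_of_nonneg hθ0.le, ← hd] at this
      filter_upwards [this.eventually (gt_mem_nhds hθρ)] with η hη
      rwa [dist_eq_norm]
    have ev3 : ∀ᶠ η : ℝ in 𝓝[>] 0, z + η • e3 ∈ Metric.thickening r (segment ℝ z y) :=
      t0.eventually (Metric.isOpen_thickening.mem_nhds
        (Metric.self_subset_thickening hr _ (left_mem_segment ℝ z y)))
    obtain ⟨η, ⟨⟨h1, h2⟩, h3⟩, hη⟩ := (((ev1.and ev2).and ev3).and self_mem_nhdsWithin).exists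
    have hη : 0 < η := hη
    have hΩ : z + η • e3 ∈ halfSpace := by
      have : (z + η • e3) 2 = z 2 + η := by simp [e3]
      change 0 < (z + η • e3) 2
      rw [this]; linarith
    refine ⟨halfSpace ∩ Metric.thickening r (segment ℝ z y), z + η • e3,
      h.subset_or_disjoint ht hT inter_subset_left fun w hw hwK => ?_, ⟨hΩ, h3⟩, hΩ, h2, h1,
      r, hr, fun w hw hwy => ⟨hw, ?_⟩⟩
    · exact Set.disjoint_left.1 hdis hw.2 (Metric.self_subset_thickening hr _ hwK)
    · exact Metric.mem_thickening_iff.2 ⟨y, right_mem_segment ℝ z y, hwy⟩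
  have hkd : |inner ℝ (y - x) (N t v)| ≤ d := by
    have := abs_real_inner_le_norm (y - x) (N t v)
    rwa [hN1, mul_one] at this
  have hc : ∀ k : ℝ, 0 < k → k ≤ d → 0 < k / (2 * d) ∧ k / (2 * d) < 1 ∧ k / (2 * d) * d < k := by
    intro k hk hkd
    refine ⟨by positivity, ?_, ?_⟩
    · rw [div_lt_one (by positivity)]; linarith
    · field_simp; linarith
  constructor
  · intro hpos
    obtain ⟨hc0, hc1, hc2⟩ := hc _ hpos ((le_abs_self _).trans hkd)
    obtain ⟨ρ, hρ, hside⟩ := h.side_of_normal ht hv hc0 hc1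
    obtain ⟨T, w, hT, hwT, hwΩ, hwx, hw, r, hr, hball⟩ := key _ ρ hρ 1
      (hc2.trans_eq (one_mul _).symm)
    rw [one_mul] at hw
    have hnot := (hside w hwΩ hwx).1 hw
    refine ⟨r, hr, fun w' hw' hwy => ?_⟩
    rcases hT with hT | hT
    · exact absurd (hT hwT) hnot
    · exact Set.disjoint_left.1 hT (hball w' hw' hwy)
  · intro hpos
    obtain ⟨hc0, hc1, hc2⟩ := hc _ hpos ((neg_le_abs _).trans hkd)
    obtain ⟨ρ, hρ, hside⟩ := h.side_of_normal ht hv hc0 hc1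
    obtain ⟨T, w, hT, hwT, hwΩ, hwx, hw, r, hr, hball⟩ := key _ ρ hρ (-1)
      (hc2.trans_eq (neg_one_mul _).symm)
    rw [neg_one_mul] at hw
    have hin := (hside w hwΩ hwx).2 hw
    refine ⟨r, hr, fun w' hw' hwy => ?_⟩
    rcases hT with hT | hT
    · exact hT (hball w' hw' hwy)
    · exact absurd hin (Set.disjoint_left.1 hT hwT)

end IsEvolution

/-- At nearest points of the surfaces of two nested sets, the connecting vector points to the
outer side of both. -/
theorem inner_normal_nonneg_of_nearest {s₁ s₂ : ℝ} {β₁ β₂ : Plane → ℝ} {E₁ E₂ : ℝ → Set Space}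
    {α₁ α₂ : ℝ≥0} {U₁ U₂ : Set Plane} {p₁ p₂ N₁ N₂ : ℝ → Plane → Space}
    (h₁ : IsEvolution S s₁ β₁ E₁ α₁ U₁ p₁ N₁) (h₂ : IsEvolution S s₂ β₂ E₂ α₂ U₂ p₂ N₂)
    {t : ℝ} (ht : t ∈ Icc 0 S) (hsub : E₁ t ⊆ E₂ t) {u₁ u₂ : Plane} (hu₁ : u₁ ∈ closure U₁)
    (hu₂ : u₂ ∈ closure U₂) (hne : p₁ t u₁ ≠ p₂ t u₂)
    (hmin : ∀ v₁ ∈ closure U₁, ∀ v₂ ∈ closure U₂,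
      dist (p₁ t u₁) (p₂ t u₂) ≤ dist (p₁ t v₁) (p₂ t v₂)) :
    0 ≤ inner ℝ (p₂ t u₂ - p₁ t u₁) (N₁ t u₁) ∧ 0 ≤ inner ℝ (p₂ t u₂ - p₁ t u₁) (N₂ t u₂) := by
  constructor
  -- Otherwise a relative neighbourhood of `p₂ t u₂` would lie in `E₁ t ⊆ E₂ t`, although this point
  -- is a limit of boundary points of `E₂ t`.
  · by_contra! hneg
    obtain ⟨r, hr, hin⟩ := (h₁.side_of_nearest ht hu₁ (h₂.height_nonneg ht hu₂) hne.symm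
      (fun v hv => hmin v hv u₂ hu₂)).2 (by linarith)
    have hcl : p₂ t u₂ ∈ closure (innerBoundary (E₂ t)) := by
      rw [h₂.closure_innerBoundary ht]; exact ⟨u₂, hu₂, rfl⟩
    obtain ⟨w, hw, hd⟩ := Metric.mem_closure_iff.1 hcl r hr
    rw [dist_comm] at hd
    refine hw.2.2 (mem_interior.2 ⟨halfSpace ∩ Metric.ball (p₂ t u₂) r, fun w' hw' => ?_,
      isOpen_halfSpace.inter Metric.isOpen_ball, hw.1, hd⟩)
    exact hsub (hin w' hw'.1 hw'.2)
  · by_contra! hneg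
    obtain ⟨r, hr, hin⟩ := (h₂.side_of_nearest ht hu₂ (h₁.height_nonneg ht hu₁) hne
      (fun v hv => by
        rw [dist_comm (p₂ t u₂), dist_comm (p₂ t v)]; exact hmin u₁ hu₁ v hv)).1 (by
          rw [← neg_sub, inner_neg_left]; linarith)
    have hcl : p₁ t u₁ ∈ closure (innerBoundary (E₁ t)) := by
      rw [h₁.closure_innerBoundary ht]; exact ⟨u₁, hu₁, rfl⟩
    obtain ⟨w, hw, hd⟩ := Metric.mem_closure_iff.1 hcl r hr
    rw [dist_comm] at hd
    obtain ⟨w', hw', hwE⟩ := mem_closure_iff.1 hw.2.1 _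
      (isOpen_halfSpace.inter (Metric.isOpen_ball (x := p₁ t u₁) (ε := r))) ⟨hw.1, hd⟩
    exact hin w' hw'.1 hw'.2 (hsub hwE)

/-! ### Comparison of the mean curvatures at nearest interior points -/

theorem hasDerivAt_along {q : Plane → Space} {u w : Plane} {r : ℝ}
    (hq : DifferentiableAt ℝ q (u + r • w)) :
    HasDerivAt (fun r : ℝ => q (u + r • w)) (fderiv ℝ q (u + r • w) w) r := by
  have h1 : HasDerivAt (fun r : ℝ => u + r • w) w r := by
    simpa using ((hasDerivAt_id r).smul_const w).const_add u
  exact hq.hasFDerivAt.comp_hasDerivAt r h1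

/-- Both points move along curves with the same initial velocity in space. In the second derivative
of the squared distance the velocity term cancels, and only the accelerations paired with `d n`
remain. -/
theorem second_variation {q₁ q₂ : Plane → Space} {u₁ u₂ : Plane} (hq₁ : ContDiffAt ℝ 2 q₁ u₁)
    (hq₂ : ContDiffAt ℝ 2 q₂ u₂)
    (hmin : ∀ᶠ z : Plane × Plane in 𝓝 (u₁, u₂),
      dist (q₁ u₁) (q₂ u₂) ≤ dist (q₁ z.1) (q₂ z.2))
    {n : Space} {d : ℝ} (hd : 0 < d) (hn : q₂ u₂ - q₁ u₁ = d • n) {w₁ w₂ : Plane}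
    (hw : fderiv ℝ q₁ u₁ w₁ = fderiv ℝ q₂ u₂ w₂) :
    inner ℝ (fderiv ℝ (fderiv ℝ q₁) u₁ w₁ w₁) n ≤ inner ℝ (fderiv ℝ (fderiv ℝ q₂) u₂ w₂ w₂) n := by
  have tline : ∀ u w : Plane, Tendsto (fun r : ℝ => u + r • w) (𝓝 0) (𝓝 u) := by
    intro u w
    have : Continuous fun r : ℝ => u + r • w := by fun_prop
    simpa using this.tendsto 0
  have hev : ∀ (q : Plane → Space) (u w : Plane), ContDiffAt ℝ 2 q u →
      ∀ᶠ r : ℝ in 𝓝 0, HasDerivAt (fun r : ℝ => q (u + r • w)) (fderiv ℝ q (u + r • w) w) r := by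
    intro q u w hq
    have : ∀ᶠ v in 𝓝 u, DifferentiableAt ℝ q v :=
      (hq.eventually (by simp)).mono fun v hv => hv.differentiableAt (by norm_num)
    filter_upwards [(tline u w).eventually this] with r hr using hasDerivAt_along hr
  have hsec : ∀ (q : Plane → Space) (u w : Plane), ContDiffAt ℝ 2 q u →
      HasDerivAt (fun r : ℝ => fderiv ℝ q (u + r • w) w) (fderiv ℝ (fderiv ℝ q) u w w) 0 := by
    intro q u w hq
    have hdd : DifferentiableAt ℝ (fderiv ℝ q) u :=
      (hq.fderiv_right (m := 1) (by norm_num)).differentiableAt (by norm_num)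
    have h1 : HasDerivAt (fun r : ℝ => u + r • w) w 0 := by
      simpa using ((hasDerivAt_id (0 : ℝ)).smul_const w).const_add u
    have h2 : HasFDerivAt (fderiv ℝ q) (fderiv ℝ (fderiv ℝ q) u) (u + (0 : ℝ) • w) := by
      simpa using hdd.hasFDerivAt
    have h3 := h2.comp_hasDerivAt (0 : ℝ) h1
    exact (ContinuousLinearMap.apply ℝ Space w).hasFDerivAt.comp_hasDerivAt (0 : ℝ) h3
  have hf : ∀ᶠ r : ℝ in 𝓝 0, HasDerivAt
      (fun r : ℝ => ‖q₁ (u₁ + r • w₁) - q₂ (u₂ + r • w₂)‖ ^ 2)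
      (2 * inner ℝ (q₁ (u₁ + r • w₁) - q₂ (u₂ + r • w₂))
        (fderiv ℝ q₁ (u₁ + r • w₁) w₁ - fderiv ℝ q₂ (u₂ + r • w₂) w₂)) r := by
    filter_upwards [hev q₁ u₁ w₁ hq₁, hev q₂ u₂ w₂ hq₂] with r h1 h2
    exact (h1.sub h2).norm_sq
  have h0 := ((hev q₁ u₁ w₁ hq₁).self_of_nhds.sub (hev q₂ u₂ w₂ hq₂).self_of_nhds)
  have hf' := (h0.inner ℝ ((hsec q₁ u₁ w₁ hq₁).sub (hsec q₂ u₂ w₂ hq₂))).const_mul 2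
  have hlm : IsLocalMin (fun r : ℝ => ‖q₁ (u₁ + r • w₁) - q₂ (u₂ + r • w₂)‖ ^ 2) 0 := by
    filter_upwards [((tline u₁ w₁).prodMk_nhds (tline u₂ w₂)).eventually hmin] with r hr
    simp only [dist_eq_norm] at hr
    simp only [zero_smul, add_zero]
    exact pow_le_pow_left₀ (norm_nonneg _) hr 2
  have := second_deriv_nonneg_of_isLocalMin hf hf' hlm
  have hn' : q₁ u₁ - q₂ u₂ = -(d • n) := by rw [← hn]; abel
  simp only [zero_smul, add_zero, Pi.sub_apply, hw, sub_self, inner_zero_left, hn', inner_neg_left,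
    real_inner_smul_left, inner_sub_right] at this
  rw [real_inner_comm n, real_inner_comm n]
  by_contra! hcon
  nlinarith [mul_pos hd (sub_pos.2 hcon)]

/-- Both tangent planes are the orthogonal complement of `n`, so one orthonormal basis serves both
surfaces and `second_variation` is summed over it. -/
theorem meanCurvature_le_of_nearest {q₁ q₂ : Plane → Space} {u₁ u₂ : Plane}
    (hq₁ : ContDiffAt ℝ 2 q₁ u₁) (hq₂ : ContDiffAt ℝ 2 q₂ u₂)
    (hmin : ∀ᶠ z : Plane × Plane in 𝓝 (u₁, u₂),
      dist (q₁ u₁) (q₂ u₂) ≤ dist (q₁ z.1) (q₂ z.2))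
    {n : Space} {d : ℝ} (hd : 0 < d) (hn : q₂ u₂ - q₁ u₁ = d • n) (hn0 : n ≠ 0)
    (hi₁ : Function.Injective (fderiv ℝ q₁ u₁)) (hi₂ : Function.Injective (fderiv ℝ q₂ u₂))
    (hn₁ : ∀ w, inner ℝ (fderiv ℝ q₁ u₁ w) n = 0) (hn₂ : ∀ w, inner ℝ (fderiv ℝ q₂ u₂ w) n = 0) :
    meanCurvature q₂ n u₂ ≤ meanCurvature q₁ n u₁ := by
  have hfr : Module.finrank ℝ (LinearMap.range (fderiv ℝ q₁ u₁ : Plane →ₗ[ℝ] Space)) = 2 := by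
    rw [LinearMap.finrank_range_of_inj hi₁]; simp
  let b := (stdOrthonormalBasis ℝ
    (LinearMap.range (fderiv ℝ q₁ u₁ : Plane →ₗ[ℝ] Space))).reindex (finCongr hfr)
  have hb : ∀ k l, inner ℝ (b k : Space) (b l : Space) = if k = l then 1 else 0 := by
    intro k l
    exact orthonormal_iff_ite.1 b.orthonormal k l
  have h1 : ∀ k, ∃ w, fderiv ℝ q₁ u₁ w = (b k : Space) := fun k => (b k).2
  choose w₁ hw₁ using h1
  have h2 : ∀ k, ∃ w, fderiv ℝ q₂ u₂ w = (b k : Space) := fun k =>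
    mem_range_of_inner_eq_zero _ hi₂ hn0 hn₂ (by rw [← hw₁]; exact hn₁ _)
  choose w₂ hw₂ using h2
  rw [meanCurvature_eq_sum hq₁ n w₁ (fun k l => by rw [hw₁, hw₁]; exact hb k l),
    meanCurvature_eq_sum hq₂ n w₂ (fun k l => by rw [hw₂, hw₂]; exact hb k l)]
  exact Finset.sum_le_sum fun k _ => neg_le_neg
    (second_variation hq₁ hq₂ hmin hd hn ((hw₁ k).trans (hw₂ k).symm))

/-! ### Comparison of two evolutions -/

namespace IsEvolution

/-- At an interior nearest point the connecting direction is the normal. -/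
theorem eq_normal_of_nearest (h : IsEvolution S s β E α U p N) {t : ℝ} (ht : t ∈ Icc 0 S)
    {u : Plane} (hu : u ∈ U) {y n M : Space}
    (hmin : ∀ v ∈ closure U, dist (p t u) y ≤ dist (p t v) y) {d : ℝ} (hd : 0 < d)
    (hy : y - p t u = d • n) (hn : ‖n‖ = 1) (hM : M = N t u ∨ M = -N t u)
    (hnM : 0 ≤ inner ℝ n M) : n = M := by
  have huc := subset_closure hu
  have hN1 := (h.normal t ht).norm_eq_one u huc
  have hM1 : ‖M‖ = 1 := by rcases hM with rfl | rfl <;> simp [hN1]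
  have hAn : ∀ w, inner ℝ (fderivWithin ℝ (p t) (closure U) u w) n = 0 := by
    intro w
    have := h.inner_eq_zero_of_nearest ht hu hmin w
    rw [← neg_sub, hy, inner_neg_right, real_inner_smul_right, neg_eq_zero] at this
    exact (mul_eq_zero.1 this).resolve_left hd.ne'
  have hAM : ∀ w, inner ℝ (fderivWithin ℝ (p t) (closure U) u w) M = 0 := by
    intro w
    have := (h.normal t ht).orthogonal u huc w
    rcases hM with rfl | rfl
    · exact this
    · rw [inner_neg_right, this, neg_zero]
  rcases eq_or_eq_neg_of_orthogonal _ ((h.param t ht).immersion u huc) hM1 hAM hn hAn with h1 | h1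
  · exact h1
  · rw [h1, inner_neg_left, real_inner_self_eq_norm_sq, hM1] at hnM
    norm_num at hnM

/-- At interior points this is the equality `n = M`; the content is at the frontier. The sign in `M`
allows the same statement to be used for the inner surface with `N` and for the outer one with `-N`
and `-n`. -/
theorem inner_e3_le_of_nearest (h : IsEvolution S s β E α U p N) {t : ℝ} (ht : t ∈ Icc 0 S)
    {u : Plane} (hu : u ∈ closure U) {y n M : Space}
    (hmin : ∀ v ∈ closure U, dist (p t u) y ≤ dist (p t v) y) {d : ℝ} (hd : 0 < d)
    (hy : y - p t u = d • n) (hn : ‖n‖ = 1) (hM : M = N t u ∨ M = -N t u)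
    (hnM : 0 ≤ inner ℝ n M) (hne : u ∈ frontier U → 0 ≤ inner ℝ n e3) :
    inner ℝ n e3 ≤ inner ℝ M e3 := by
  by_cases huf : u ∈ frontier U
  · refine h.inner_e3_le_of_frontier ht huf hn hM hnM (hne huf) fun w hw => ?_
    have := h.inner_nonneg_of_nearest ht hu hmin hw
    rw [← neg_sub, hy, inner_neg_right, real_inner_smul_right] at this
    by_contra! hcon
    nlinarith [mul_pos hd hcon]
  · have huU : u ∈ U := by
      rw [closure_eq_union_frontier] at hu
      exact hu.resolve_right huf
    rw [h.eq_normal_of_nearest ht huU hmin hd hy hn hM hnM]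

theorem hasDerivAt_time (h : IsEvolution S s β E α U p N) {t : ℝ} (ht : t ∈ Ioo 0 S)
    {u : Plane} (hu : u ∈ closure U) :
    HasDerivAt (fun τ => p τ u) (deriv (fun τ => p τ u) t) t :=
  ((h.parabolic.time_differentiable u hu).differentiableAt
    (Icc_mem_nhds ht.1 ht.2)).hasDerivAt

end IsEvolution

section Comparison

variable {s₁ s₂ : ℝ} {β₁ β₂ : Plane → ℝ} {E₁ E₂ : ℝ → Set Space}
  {α₁ α₂ : ℝ≥0} {U₁ U₂ : Set Plane} {p₁ p₂ N₁ N₂ : ℝ → Plane → Space}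

theorem continuousOn_triple (h₁ : IsEvolution S s₁ β₁ E₁ α₁ U₁ p₁ N₁)
    (h₂ : IsEvolution S s₂ β₂ E₂ α₂ U₂ p₂ N₂) :
    ContinuousOn (fun z : ℝ × Plane × Plane => p₁ z.1 z.2.1)
        (Icc 0 S ×ˢ closure U₁ ×ˢ closure U₂) ∧
      ContinuousOn (fun z : ℝ × Plane × Plane => p₂ z.1 z.2.2)
        (Icc 0 S ×ˢ closure U₁ ×ˢ closure U₂) :=
  ⟨h₁.parabolic.continuousOn.comp (f := fun z : ℝ × Plane × Plane => (z.1, z.2.1))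
      (by fun_prop) fun _ hz => ⟨hz.1, hz.2.1⟩,
    h₂.parabolic.continuousOn.comp (f := fun z : ℝ × Plane × Plane => (z.1, z.2.2))
      (by fun_prop) fun _ hz => ⟨hz.1, hz.2.2⟩⟩

/-- The contact angles are uniformly separated at close points. -/
theorem exists_angle_gap (h₁ : IsEvolution S s₁ β₁ E₁ α₁ U₁ p₁ N₁)
    (h₂ : IsEvolution S s₂ β₂ E₂ α₂ U₂ p₂ N₂) (hβ : ∀ x, β₂ x < β₁ x) :
    ∃ ε : ℝ, 0 < ε ∧ ∀ t ∈ Icc 0 S, ∀ u₁ ∈ closure U₁, ∀ u₂ ∈ closure U₂,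
      dist (p₁ t u₁) (p₂ t u₂) ≤ ε →
        2 * ε ≤ β₁ (toPlane (p₁ t u₁)) - β₂ (toPlane (p₂ t u₂)) := by
  obtain ⟨c₁, c₂⟩ := continuousOn_triple h₁ h₂
  have hZ : IsCompact (Icc 0 S ×ˢ closure U₁ ×ˢ closure U₂) :=
    isCompact_Icc.prod (h₁.isCompact_closure.prod h₂.isCompact_closure)
  -- The maximum of the angle difference and the distance is positive everywhere, hence at least
  -- some `m > 0` by compactness. When the distance is at most `m / 2`, the angle difference must be
  -- the one that reaches `m`.
  have hF : ContinuousOn (fun z : ℝ × Plane × Plane =>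
      max (β₁ (toPlane (p₁ z.1 z.2.1)) - β₂ (toPlane (p₂ z.1 z.2.2)))
        (dist (p₁ z.1 z.2.1) (p₂ z.1 z.2.2))) (Icc 0 S ×ˢ closure U₁ ×ˢ closure U₂) := by
    refine (continuous_fst.max continuous_snd).comp_continuousOn
      (ContinuousOn.prodMk (ContinuousOn.sub ?_ ?_)
        (continuous_dist.comp_continuousOn (c₁.prodMk c₂)))
    · exact (h₁.angle.contDiff.continuous.comp continuous_toPlane).comp_continuousOn c₁
    · exact (h₂.angle.contDiff.continuous.comp continuous_toPlane).comp_continuousOn c₂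
  obtain ⟨m, hm, hle⟩ := exists_pos_le_of_isCompact hZ hF (by
    rintro ⟨t, u₁, u₂⟩ -
    by_cases heq : p₁ t u₁ = p₂ t u₂
    · exact lt_max_of_lt_left (by simpa [heq] using hβ (toPlane (p₂ t u₂)))
    · exact lt_max_of_lt_right (dist_pos.2 heq))
  refine ⟨m / 2, by positivity, fun t ht u₁ hu₁ u₂ hu₂ hd => ?_⟩
  have h3 := hle (t, u₁, u₂) ⟨ht, hu₁, hu₂⟩
  rcases le_max_iff.1 h3 with h4 | h4
  · simp only at h4; linarith
  · simp only at h4; linarith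

/-- If the surfaces of two nested evolutions are close, their distance is attained only at
interior points. -/
theorem exists_interior_of_nearest (h₁ : IsEvolution S s₁ β₁ E₁ α₁ U₁ p₁ N₁)
    (h₂ : IsEvolution S s₂ β₂ E₂ α₂ U₂ p₂ N₂) (hβ : ∀ x, β₂ x < β₁ x) :
    ∃ δ : ℝ, 0 < δ ∧ ∀ t ∈ Icc 0 S, E₁ t ⊆ E₂ t → ∀ u₁ ∈ closure U₁, ∀ u₂ ∈ closure U₂,
      p₁ t u₁ ≠ p₂ t u₂ →
      (∀ v₁ ∈ closure U₁, ∀ v₂ ∈ closure U₂,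
        dist (p₁ t u₁) (p₂ t u₂) ≤ dist (p₁ t v₁) (p₂ t v₂)) →
      dist (p₁ t u₁) (p₂ t u₂) ≤ δ → u₁ ∈ U₁ ∧ u₂ ∈ U₂ := by
  obtain ⟨ε, hε, hgap⟩ := exists_angle_gap h₁ h₂ hβ
  obtain ⟨δ₁, hδ₁, hc₁⟩ := h₁.exists_contact_near hε
  obtain ⟨δ₂, hδ₂, hc₂⟩ := h₂.exists_contact_near hε
  refine ⟨min ε (min δ₁ δ₂), lt_min hε (lt_min hδ₁ hδ₂), ?_⟩
  intro t ht hsub u₁ hu₁ u₂ hu₂ hne hmin hdist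
  by_contra hcon
  have hfr : u₁ ∈ frontier U₁ ∨ u₂ ∈ frontier U₂ := by
    rw [closure_eq_union_frontier] at hu₁ hu₂
    by_contra! hno
    exact hcon ⟨hu₁.resolve_right hno.1, hu₂.resolve_right hno.2⟩
  have d1 := hdist.trans (min_le_left _ _)
  have d2 := (hdist.trans (min_le_right _ _)).trans (min_le_left _ _)
  have d3 := (hdist.trans (min_le_right _ _)).trans (min_le_right _ _)
  have hd0 : 0 < dist (p₁ t u₁) (p₂ t u₂) := dist_pos.2 hne
  set d := dist (p₁ t u₁) (p₂ t u₂) with hd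
  have hheight : |p₁ t u₁ 2 - p₂ t u₂ 2| ≤ d := by
    rw [hd, dist_eq_norm]
    simpa [inner_e3, norm_e3] using abs_real_inner_le_norm (p₁ t u₁ - p₂ t u₂) e3
  have hh₁ := h₁.height_nonneg ht hu₁
  have hh₂ := h₂.height_nonneg ht hu₂
  -- One of the points is on `∂Ω` and the other is within `d` of it, so both are low enough for the
  -- approximate contact condition.
  have hlow : p₁ t u₁ 2 ≤ d ∧ p₂ t u₂ 2 ≤ d := by
    rw [abs_le] at hheight
    rcases hfr with hf | hf
    · have := (h₁.param t ht).height_zero u₁ hf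
      constructor <;> linarith
    · have := (h₂.param t ht).height_zero u₂ hf
      constructor <;> linarith
  set n := d⁻¹ • (p₂ t u₂ - p₁ t u₁) with hn
  have hdn : p₂ t u₂ - p₁ t u₁ = d • n := by rw [hn, smul_inv_smul₀ hd0.ne']
  have hn1 : ‖n‖ = 1 := by
    rw [hn, norm_smul, norm_inv, Real.norm_of_nonneg hd0.le, ← dist_eq_norm,
      dist_comm (p₂ t u₂), ← hd, inv_mul_cancel₀ hd0.ne']
  obtain ⟨hs₁, hs₂⟩ := inner_normal_nonneg_of_nearest h₁ h₂ ht hsub hu₁ hu₂ hne hmin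
  rw [hdn, real_inner_smul_left] at hs₁ hs₂
  have hs₁ := nonneg_of_mul_nonneg_right hs₁ hd0
  have hs₂ := nonneg_of_mul_nonneg_right hs₂ hd0
  have hne3 : d * inner ℝ n e3 = p₂ t u₂ 2 - p₁ t u₁ 2 := by
    rw [← real_inner_smul_left, ← hdn, inner_e3]; simp
  -- `i1` and `i2` say `N₂ · e₃ ≤ n · e₃ ≤ N₁ · e₃`. Together with the contact conditions up to `ε`
  -- this forces `β₁ - β₂ < 2 ε`, against the gap.
  have i1 := h₁.inner_e3_le_of_nearest ht hu₁ (fun v hv => hmin v hv u₂ hu₂) hd0 hdn hn1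
    (Or.inl rfl) hs₁ (fun hf => by
      have := (h₁.param t ht).height_zero u₁ hf
      rw [this, sub_zero] at hne3
      exact nonneg_of_mul_nonneg_right (hne3 ▸ hh₂) hd0)
  have i2 := h₂.inner_e3_le_of_nearest ht hu₂ (y := p₁ t u₁) (n := -n)
    (fun v hv => by
      rw [dist_comm (p₂ t u₂), dist_comm (p₂ t v)]; exact hmin u₁ hu₁ v hv) hd0
    (by rw [← neg_sub, hdn, smul_neg]) (by rw [norm_neg, hn1]) (Or.inr rfl)
    (by rwa [inner_neg_neg]) (fun hf => by
      have := (h₂.param t ht).height_zero u₂ hf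
      rw [this, zero_sub] at hne3
      rw [inner_neg_left]
      by_contra! hlt
      nlinarith)
  rw [inner_neg_left, inner_neg_left] at i2
  have k1 := (abs_lt.1 (hc₁ t ht u₁ hu₁ (hlow.1.trans d2))).2
  have k2 := (abs_lt.1 (hc₂ t ht u₂ hu₂ (hlow.2.trans d3))).1
  have k3 := hgap t ht u₁ hu₁ u₂ hu₂ d1
  linarith

/-- At interior nearest points of nested evolutions the distance does not decrease. -/
theorem inner_velocity_nonneg (h₁ : IsEvolution S s₁ β₁ E₁ α₁ U₁ p₁ N₁)
    (h₂ : IsEvolution S s₂ β₂ E₂ α₂ U₂ p₂ N₂) (hs : s₁ ≤ s₂) {t : ℝ} (ht : t ∈ Ioo 0 S)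
    (hsub : E₁ t ⊆ E₂ t) {u₁ u₂ : Plane} (hu₁ : u₁ ∈ U₁) (hu₂ : u₂ ∈ U₂)
    (hne : p₁ t u₁ ≠ p₂ t u₂)
    (hmin : ∀ v₁ ∈ closure U₁, ∀ v₂ ∈ closure U₂,
      dist (p₁ t u₁) (p₂ t u₂) ≤ dist (p₁ t v₁) (p₂ t v₂)) :
    0 ≤ inner ℝ (p₁ t u₁ - p₂ t u₂)
      (deriv (fun τ => p₁ τ u₁) t - deriv (fun τ => p₂ τ u₂) t) := by
  have ht' : t ∈ Icc 0 S := Ioo_subset_Icc_self ht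
  have hu₁' := subset_closure hu₁
  have hu₂' := subset_closure hu₂
  have hd0 : 0 < dist (p₁ t u₁) (p₂ t u₂) := dist_pos.2 hne
  set d := dist (p₁ t u₁) (p₂ t u₂) with hd
  set n := d⁻¹ • (p₂ t u₂ - p₁ t u₁) with hn
  have hdn : p₂ t u₂ - p₁ t u₁ = d • n := by rw [hn, smul_inv_smul₀ hd0.ne']
  have hn1 : ‖n‖ = 1 := by
    rw [hn, norm_smul, norm_inv, Real.norm_of_nonneg hd0.le, ← dist_eq_norm,
      dist_comm (p₂ t u₂), ← hd, inv_mul_cancel₀ hd0.ne']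
  have hn0 : n ≠ 0 := by rintro h0; rw [h0, norm_zero] at hn1; norm_num at hn1
  obtain ⟨hs₁, hs₂⟩ := inner_normal_nonneg_of_nearest h₁ h₂ ht' hsub hu₁' hu₂' hne hmin
  rw [hdn, real_inner_smul_left] at hs₁ hs₂
  have hs₁ := nonneg_of_mul_nonneg_right hs₁ hd0
  have hs₂ := nonneg_of_mul_nonneg_right hs₂ hd0
  have e1 : n = N₁ t u₁ := h₁.eq_normal_of_nearest ht' hu₁ (fun v hv => hmin v hv u₂ hu₂') hd0
    hdn hn1 (Or.inl rfl) hs₁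
  have e2 : -n = -N₂ t u₂ := h₂.eq_normal_of_nearest ht' hu₂ (y := p₁ t u₁)
    (fun v hv => by
      rw [dist_comm (p₂ t u₂), dist_comm (p₂ t v)]; exact hmin u₁ hu₁' v hv) hd0
    (by rw [← neg_sub, hdn, smul_neg]) (by rw [norm_neg, hn1]) (Or.inr rfl)
    (by rwa [inner_neg_neg])
  have e2 : n = N₂ t u₂ := neg_injective e2
  have n1 : closure U₁ ∈ 𝓝 u₁ := Filter.mem_of_superset (h₁.domain.isOpen.mem_nhds hu₁)
    subset_closure
  have n2 : closure U₂ ∈ 𝓝 u₂ := Filter.mem_of_superset (h₂.domain.isOpen.mem_nhds hu₂)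
    subset_closure
  have hi₁ := (h₁.param t ht').immersion u₁ hu₁'
  have hi₂ := (h₂.param t ht').immersion u₂ hu₂'
  have ho₁ := (h₁.normal t ht').orthogonal u₁ hu₁'
  have ho₂ := (h₂.normal t ht').orthogonal u₂ hu₂'
  rw [fderivWithin_of_mem_nhds n1] at hi₁ ho₁
  rw [fderivWithin_of_mem_nhds n2] at hi₂ ho₂
  rw [← e1] at ho₁
  rw [← e2] at ho₂
  have hκ := meanCurvature_le_of_nearest ((h₁.param t ht').contDiffOn.contDiffAt n1)
    ((h₂.param t ht').contDiffOn.contDiffAt n2)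
    (by
      filter_upwards [prod_mem_nhds n1 n2] with z hz using hmin z.1 hz.1 z.2 hz.2)
    hd0 hdn hn0 hi₁ hi₂ ho₁ ho₂
  have l1 := h₁.law t ht u₁ hu₁
  have l2 := h₂.law t ht u₂ hu₂
  rw [← e1] at l1
  rw [← e2] at l2
  -- The quantity equals `d (κ₁ - κ₂ + s₂ - s₁)`, since `n` is the outer normal of both surfaces.
  rw [← neg_sub (p₂ t u₂), hdn, inner_neg_left, real_inner_smul_left, inner_sub_right,
    real_inner_comm _ n, real_inner_comm _ n, l1, l2]
  have : 0 ≤ d * (meanCurvature (p₁ t) n u₁ - meanCurvature (p₂ t) n u₂ + (s₂ - s₁)) :=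
    mul_nonneg hd0.le (by linarith)
  linarith

/-- Two evolutions which are strictly nested initially remain disjoint. -/
theorem disjoint_of_evolutions (h₁ : IsEvolution S s₁ β₁ E₁ α₁ U₁ p₁ N₁)
    (h₂ : IsEvolution S s₂ β₂ E₂ α₂ U₂ p₂ N₂) (hs : s₁ ≤ s₂) (hβ : ∀ x, β₂ x < β₁ x)
    (h0 : E₁ 0 ⊆ E₂ 0) {δ : ℝ} (hδ : 0 < δ)
    (hdist : ∀ x ∈ p₁ 0 '' closure U₁, ∀ y ∈ p₂ 0 '' closure U₂, δ ≤ dist x y) :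
    ∀ t ∈ Ico 0 S, Disjoint (p₁ t '' closure U₁) (p₂ t '' closure U₂) := by
  intro t ht
  by_contra hnd
  obtain ⟨_, ⟨w₁, hw₁, rfl⟩, ⟨w₂, hw₂, hw⟩⟩ := Set.not_disjoint_iff.1 hnd
  have hS := h₁.pos
  obtain ⟨δ₀, hδ₀, hint⟩ := exists_interior_of_nearest h₁ h₂ hβ
  set d₀ := min δ δ₀ with hd₀
  have hd₀pos : 0 < d₀ := lt_min hδ hδ₀
  set l := d₀ ^ 2 / 2 with hl
  have hlpos : 0 < l := by positivity
  have hld : l < d₀ ^ 2 := by rw [hl]; linarith [pow_pos hd₀pos 2]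
  -- Over the whole interval the added term `ε t` is at most `l / 2`, so the level `l` is reached
  -- while `dist² ≥ l / 2 > 0`, before contact.
  set ε := l / (2 * S) with hε
  have hεpos : 0 < ε := by positivity
  have hεr : ∀ r ∈ Icc 0 S, ε * r ≤ l / 2 := by
    intro r hr
    calc ε * r ≤ ε * S := by gcongr; exact hr.2
      _ = l / 2 := by rw [hε]; field_simp
  set Z := Icc 0 S ×ˢ closure U₁ ×ˢ closure U₂ with hZ
  have hZc : IsCompact Z :=
    isCompact_Icc.prod (h₁.isCompact_closure.prod h₂.isCompact_closure)
  obtain ⟨c₁, c₂⟩ := continuousOn_triple h₁ h₂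
  have hF : ContinuousOn (fun z : ℝ × Plane × Plane =>
      dist (p₁ z.1 z.2.1) (p₂ z.1 z.2.2) ^ 2 + ε * z.1) Z :=
    ((continuous_dist.comp_continuousOn (c₁.prodMk c₂)).pow 2).add (by fun_prop)
  have hB : IsCompact (Z ∩ (fun z : ℝ × Plane × Plane =>
      dist (p₁ z.1 z.2.1) (p₂ z.1 z.2.2) ^ 2 + ε * z.1) ⁻¹' Iic l) :=
    hZc.of_isClosed_subset (hF.preimage_isClosed_of_isClosed hZc.isClosed isClosed_Iic)
      inter_subset_left
  have htS : t ∈ Icc 0 S := ⟨ht.1, ht.2.le⟩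
  obtain ⟨r, ⟨⟨r', u₁, u₂⟩, ⟨⟨hr, hu₁, hu₂⟩, hle⟩, rfl⟩, hleast⟩ :=
    (hB.image continuous_fst).exists_isLeast ⟨t, (t, w₁, w₂), ⟨⟨htS, hw₁, hw₂⟩, by
      change dist (p₁ t w₁) (p₂ t w₂) ^ 2 + ε * t ≤ l
      rw [hw, dist_self]
      linarith [hεr t htS]⟩, rfl⟩
  change r' ∈ Icc 0 S at hr
  change u₁ ∈ closure U₁ at hu₁
  change u₂ ∈ closure U₂ at hu₂
  change dist (p₁ r' u₁) (p₂ r' u₂) ^ 2 + ε * r' ≤ l at hle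
  have hrt : r' ≤ t := hleast ⟨(t, w₁, w₂), ⟨⟨htS, hw₁, hw₂⟩, by
      change dist (p₁ t w₁) (p₂ t w₂) ^ 2 + ε * t ≤ l
      rw [hw, dist_self]
      linarith [hεr t htS]⟩, rfl⟩
  have hr0 : 0 < r' := by
    refine lt_of_le_of_ne hr.1 ?_
    rintro rfl
    have h1 := hdist _ ⟨u₁, hu₁, rfl⟩ _ ⟨u₂, hu₂, rfl⟩
    have h2 : d₀ ^ 2 ≤ dist (p₁ 0 u₁) (p₂ 0 u₂) ^ 2 :=
      pow_le_pow_left₀ hd₀pos.le ((min_le_left _ _).trans h1) 2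
    linarith
  have hrS : r' ∈ Ioo 0 S := ⟨hr0, hrt.trans_lt ht.2⟩
  have hbefore : ∀ τ ∈ Ico 0 r', ∀ v₁ ∈ closure U₁, ∀ v₂ ∈ closure U₂,
      l < dist (p₁ τ v₁) (p₂ τ v₂) ^ 2 + ε * τ := by
    intro τ hτ v₁ hv₁ v₂ hv₂
    by_contra! hcon
    have := hleast ⟨(τ, v₁, v₂), ⟨⟨⟨hτ.1, hτ.2.le.trans hr.2⟩, hv₁, hv₂⟩, hcon⟩, rfl⟩
    exact absurd hτ.2 (not_lt.2 this)
  -- Continuity from the left: at the first time `r'` no pair has passed below the level, so the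
  -- pair attaining it realizes the distance of the surfaces.
  have hat : ∀ v₁ ∈ closure U₁, ∀ v₂ ∈ closure U₂,
      l ≤ dist (p₁ r' v₁) (p₂ r' v₂) ^ 2 + ε * r' := by
    intro v₁ hv₁ v₂ hv₂
    have hsub : Ioo 0 r' ⊆ Icc 0 S := fun τ hτ => ⟨hτ.1.le, hτ.2.le.trans hr.2⟩
    have hc : Tendsto (fun τ => dist (p₁ τ v₁) (p₂ τ v₂) ^ 2 + ε * τ) (𝓝[Ioo 0 r'] r')
        (𝓝 (dist (p₁ r' v₁) (p₂ r' v₂) ^ 2 + ε * r')) := by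
      have k1 : Tendsto (fun τ => p₁ τ v₁) (𝓝[Ioo 0 r'] r') (𝓝 (p₁ r' v₁)) :=
        (h₁.continuousOn_time hv₁ r' hr).mono_left (nhdsWithin_mono _ hsub)
      have k2 : Tendsto (fun τ => p₂ τ v₂) (𝓝[Ioo 0 r'] r') (𝓝 (p₂ r' v₂)) :=
        (h₂.continuousOn_time hv₂ r' hr).mono_left (nhdsWithin_mono _ hsub)
      exact ((k1.dist k2).pow 2).add (tendsto_nhdsWithin_of_tendsto_nhds tendsto_id |>.const_mul ε)
    have := right_nhdsWithin_Ioo_neBot hr0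
    refine ge_of_tendsto hc ?_
    filter_upwards [self_mem_nhdsWithin] with τ hτ
    exact (hbefore τ ⟨hτ.1.le, hτ.2⟩ v₁ hv₁ v₂ hv₂).le
  have heq : dist (p₁ r' u₁) (p₂ r' u₂) ^ 2 + ε * r' = l := le_antisymm hle (hat u₁ hu₁ u₂ hu₂)
  have hεr' := hεr r' hr
  have hne : p₁ r' u₁ ≠ p₂ r' u₂ := by
    intro h
    rw [h, dist_self] at heq
    linarith
  have hmin : ∀ v₁ ∈ closure U₁, ∀ v₂ ∈ closure U₂,
      dist (p₁ r' u₁) (p₂ r' u₂) ≤ dist (p₁ r' v₁) (p₂ r' v₂) := by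
    intro v₁ hv₁ v₂ hv₂
    refine le_of_sq_le_sq ?_ dist_nonneg
    linarith [hat v₁ hv₁ v₂ hv₂]
  have hsmall : dist (p₁ r' u₁) (p₂ r' u₂) ≤ δ₀ := by
    refine le_trans (le_of_sq_le_sq ?_ hd₀pos.le) (min_le_right δ δ₀)
    have := mul_pos hεpos hr0
    linarith
  have hincl : E₁ r' ⊆ E₂ r' := by
    refine inclusion_of_disjoint h₁ h₂ hr h0 fun τ hτ => Set.disjoint_left.2 ?_
    rintro _ ⟨v₁, hv₁, rfl⟩ ⟨v₂, hv₂, hv⟩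
    have hτS : τ ∈ Icc 0 S := ⟨hτ.1, hτ.2.trans hr.2⟩
    have : l ≤ dist (p₁ τ v₁) (p₂ τ v₂) ^ 2 + ε * τ := by
      rcases hτ.2.eq_or_lt with rfl | hlt
      · exact hat v₁ hv₁ v₂ hv₂
      · exact (hbefore τ ⟨hτ.1, hlt⟩ v₁ hv₁ v₂ hv₂).le
    rw [hv, dist_self] at this
    linarith [hεr τ hτS]
  obtain ⟨hi₁, hi₂⟩ := hint r' hr hincl u₁ hu₁ u₂ hu₂ hne hmin hsmall
  have hvel := inner_velocity_nonneg h₁ h₂ hs hrS hincl hi₁ hi₂ hne hmin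
  have hder : HasDerivAt (fun τ => ‖p₁ τ u₁ - p₂ τ u₂‖ ^ 2 + ε * τ)
      (2 * inner ℝ (p₁ r' u₁ - p₂ r' u₂)
        (deriv (fun τ => p₁ τ u₁) r' - deriv (fun τ => p₂ τ u₂) r') + ε * 1) r' :=
    (((h₁.hasDerivAt_time hrS hu₁).sub (h₂.hasDerivAt_time hrS hu₂)).norm_sq).add
      ((hasDerivAt_id r').const_mul ε)
  have hsl := hder.tendsto_slope.mono_left
    (nhdsWithin_mono r' (fun τ (hτ : τ ∈ Ioo 0 r') => hτ.2.ne))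
  have hneBot := right_nhdsWithin_Ioo_neBot hr0
  -- For this fixed pair the function is above `l` before `r'` and equals `l` at `r'`, so its
  -- derivative is nonpositive, whereas `hvel` makes it at least `ε`.
  have hnonpos := le_of_tendsto hsl (b := 0) (by
    filter_upwards [self_mem_nhdsWithin] with τ hτ
    have hb := hbefore τ ⟨hτ.1.le, hτ.2⟩ u₁ hu₁ u₂ hu₂
    rw [dist_eq_norm] at hb heq
    rw [slope_def_field]
    refine div_nonpos_of_nonneg_of_nonpos ?_ (by linarith [hτ.2])
    linarith)
  linarith

end Comparison

/-! ### From smooth flows to evolutions on a fixed interval, and the theorem -/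

theorem le_dist_of_mem_closure {X : Type*} [PseudoMetricSpace X] {A B : Set X} {δ : ℝ}
    (h : ∀ x ∈ A, ∀ y ∈ B, δ ≤ dist x y) {x y : X} (hx : x ∈ closure A) (hy : y ∈ closure B) :
    δ ≤ dist x y := by
  refine le_of_forall_pos_lt_add fun ε hε => ?_
  obtain ⟨a, ha, hxa⟩ := Metric.mem_closure_iff.1 hx (ε / 2) (by positivity)
  obtain ⟨b, hb, hyb⟩ := Metric.mem_closure_iff.1 hy (ε / 2) (by positivity)
  have h1 := h a ha b hb
  have h2 := dist_triangle4 a x y b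
  rw [dist_comm a x] at h2
  linarith

theorem IsSmoothFlow.exists_evolution {T : EReal} (h : IsSmoothFlow T s β E) (hS : 0 < S)
    (hST : (S : EReal) < T) : ∃ (α : ℝ≥0) (U : Set Plane) (p N : ℝ → Plane → Space),
      IsEvolution S s β E α U p N := by
  obtain ⟨α, U, p, N, -, -, hU, hp, hpar, hN, hc, hlaw⟩ := h.evolution S hS hST
  exact ⟨α, U, p, N, hS, hU, hp, hpar, hN, hc, hlaw,
    fun t ht => h.droplet t ht.1 ((EReal.coe_le_coe_iff.2 ht.2).trans_lt hST), h.angle⟩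

end Droplet

end

theorem mainTheorem5 (T : EReal) (s₁ s₂ : ℝ) (β₁ β₂ : Droplet.Plane → ℝ)
    (E₁ E₂ : ℝ → Set Droplet.Space)
    (hE₁ : Droplet.IsSmoothFlow T s₁ β₁ E₁) (hE₂ : Droplet.IsSmoothFlow T s₂ β₂ E₂)
    (h0 : Droplet.StrictlyInside (E₁ 0) (E₂ 0)) (hs : s₁ ≤ s₂) (hβ : ∀ x, β₂ x < β₁ x) :
    ∀ t : ℝ, 0 ≤ t → (t : EReal) < T → Droplet.StrictlyInside (E₁ t) (E₂ t) := by
  intro t ht htT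
  -- The law holds only on the open interval `(0, S)`, so `S` is taken strictly beyond `t`.
  obtain ⟨S, htS, hST⟩ := EReal.lt_iff_exists_real_btwn.1 htT
  have htS : t < S := EReal.coe_lt_coe_iff.1 htS
  have hS : 0 < S := ht.trans_lt htS
  obtain ⟨α₁, U₁, p₁, N₁, h₁⟩ := hE₁.exists_evolution hS hST
  obtain ⟨α₂, U₂, p₂, N₂, h₂⟩ := hE₂.exists_evolution hS hST
  obtain ⟨hsub, δ, hδ, hdist⟩ := h0
  have h00 : (0 : ℝ) ∈ Icc 0 S := ⟨le_rfl, hS.le⟩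
  have htI : t ∈ Icc 0 S := ⟨ht, htS.le⟩
  have hdist' : ∀ x ∈ p₁ 0 '' closure U₁, ∀ y ∈ p₂ 0 '' closure U₂, δ ≤ dist x y := by
    intro x hx y hy
    rw [← h₁.closure_innerBoundary h00] at hx
    rw [← h₂.closure_innerBoundary h00] at hy
    exact Droplet.le_dist_of_mem_closure hdist hx hy
  have hdisj : ∀ τ ∈ Ico 0 S, Disjoint (p₁ τ '' closure U₁) (p₂ τ '' closure U₂) :=
    Droplet.disjoint_of_evolutions h₁ h₂ hs hβ hsub hδ hdist'
  refine ⟨Droplet.inclusion_of_disjoint h₁ h₂ htI hsub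
    fun τ hτ => hdisj τ ⟨hτ.1, hτ.2.trans_lt htS⟩, ?_⟩
  -- The closed surfaces are compact and disjoint at time `t`, which gives the positive distance.
  obtain ⟨d, hd, hle⟩ := Droplet.exists_pos_le_of_isCompact
    ((h₁.isCompact_image htI).prod (h₂.isCompact_image htI))
    (f := fun z => dist z.1 z.2) continuous_dist.continuousOn (by
      rintro ⟨x, y⟩ ⟨hx, hy⟩
      exact dist_pos.2 fun h => Set.disjoint_left.1 (hdisj t ⟨ht, htS⟩) hx (h ▸ hy))
  refine ⟨d, hd, fun x hx y hy => hle (x, y) ⟨?_, ?_⟩⟩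
  · rw [← h₁.closure_innerBoundary htI]; exact subset_closure hx
  · rw [← h₂.closure_innerBoundary htI]; exact subset_closure hy
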